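/- **Conventions.** For $n\ge 1$ let $\Delta_n^+=\{(i,j)\mid 1\le i<j\le n\}$, and for $\sigma\in S_n$ let $\Phi(\sigma)=\{(i,j)\in\Delta_n^+\mid \sigma(i)>\sigma(j)\}$ be its inversion set. Let $\mathrm{Id}_n$ be the identity, and $w_0\in S_n$ the permutation $i\mapsto n+1-i$. A *decomposition* of a set $S\subseteq \Delta_n^+$ is a family $\Phi(u_1),\dots,\Phi(u_r)$, $u_a\in S_n$, $r\ge1$, of pairwise disjoint (possibly empty) inversion sets with $S=\Phi(u_1)\sqcup\dots\sqcup\Phi(u_r)$. A permutation $\sigma$ is *irreducible* if every decomposition $\Phi(\sigma)=\Phi(u_1)\sqcup\dots\sqcup\Phi(u_r)$ has $\Phi(u_a)=\Phi(\sigma)$ for some $a$; a decomposition of $\Delta_n^+$ is irreducible if all its $u_a$ are. A *block* of $\sigma\in S_n$ is a set of consecutive integers in $\{1,\dots,n\}$ whose image under $\sigma$ is again a set of consecutive integers; $\sigma$ is *simple* if it has no block of size $t$ with $1<t<n$. For positive integers $z_1,\dots,z_m$ with sum $n$, $\sigma\in S_m$ and $\beta_b\in S_{z_b}$, the *inflation*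 $\sigma[\beta_1,\dots,\beta_m]\in S_n$ is the permutation $$z_1+\dots+z_{b-1}+k\;\longmapsto\;\sum_{b'\,:\,\sigma(b')<\sigma(b)}z_{b'}+\beta_b(k)\qquad(1\le b\le m,\ 1\le k\le z_b).$$ A permutation is *minus-decomposable* if it equals $w_0[\alpha,\beta]$ with $w_0\in S_2$ for some permutations $\alpha,\beta$ (of positive sizes), and *minus-indecomposable* otherwise. **Theorem 1.6.** Let $r\ge 1$, and let $\Delta_n^+=\Phi(w_1)\sqcup\dots\sqcup\Phi(w_r)$ be a decomposition with all $\Phi(w_a)\ne\emptyset$ (so $n\ge2$). Then, after possibly reordering the $w_a$, there are $m$, positive integers $z_1,\dots,z_m$ with sum $n$, and permutations $\sigma_a\in S_m$ and $\beta_{ab}\in S_{z_b}$ ($1\le a\le r$, $1\le b\le m$), and $q\in\{2,3\}$, such that $$w_a=\sigma_a[\beta_{a1},\dots,\beta_{am}]\qquad (a=1,\dots,r),$$ $$(\dag)\qquad \Delta^+_{z_b}=\Phi(\beta_{1b})\sqcup\dots\sqcup\Phi(\beta_{rb})\ \text{ is a decomposition}\qquad (b=1,\dots,m),$$ $\sigma_q=\sigma_{q+1}=\dots=\sigma_r=\mathrm{Id}_m$,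 and - if $w_1$ is minus-decomposable: $m\ge2$, $\sigma_1=w_0$ and $q=2$; - if $w_1$ is minus-indecomposable: $m\ge4$, $\sigma_1$ is simple, $r\ge 2$, $\sigma_2=w_0\sigma_1$ and $q=3$. Moreover, for every ordering of the $w_a$ and every such choice of $m$, $z_b$, $\sigma_a$, $\beta_{ab}$, $q$, the decomposition $\Delta_n^+=\Phi(w_1)\sqcup\dots\sqcup\Phi(w_r)$ is irreducible if and only if the decompositions $(\dag)$ are irreducible for all $b$, for each $a=q,q+1,\dots,r$ exactly one of $\beta_{a1},\dots,\beta_{am}$ is not the identity, and - if $w_1$ is minus-decomposable: $m=2$, $\beta_{11}=\mathrm{Id}_{z_1}$ and $\beta_{12}=\mathrm{Id}_{z_2}$; - if $w_1$ is minus-indecomposable: $\beta_{1b}=\beta_{2b}=\mathrm{Id}_{z_b}$ for all $b=1,\dots,m$. -/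

import Mathlib

/-! Permutations in `S_n` are `Equiv.Perm (Fin n)`; letters are numbered `0, …, n-1` instead of
`1, …, n`.  As usual `(σ * τ) i = σ (τ i)`, and `1` is the identity `Id`. -/

namespace InvDecomp

open Equiv

/-- The positive roots `Δ_n⁺ = {(i, j) | i < j}`. -/
def posRoots (n : ℕ) : Set (Fin n × Fin n) := {p | p.1 < p.2}

/-- The inversion set `Φ(σ) = {(i, j) ∈ Δ_n⁺ | σ(i) > σ(j)}`. -/
def invSet {n : ℕ} (σ : Perm (Fin n)) : Set (Fin n × Fin n) :=
  {p | p ∈ posRoots n ∧ σ p.2 < σ p.1}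

/-- The order-reversing permutation `w₀ = (n, n-1, …, 1)`. -/
def w0 (n : ℕ) : Perm (Fin n) := Fin.revPerm

/-- `S = Φ(u_1) ⊔ ⋯ ⊔ Φ(u_r)`, a disjoint union. Empty `Φ(u_a)` are allowed. -/
def IsDecomposition {n r : ℕ} (S : Set (Fin n × Fin n)) (u : Fin r → Perm (Fin n)) : Prop :=
  (∀ a a', a ≠ a' → Disjoint (invSet (u a)) (invSet (u a'))) ∧ S = ⋃ a, invSet (u a)

/-- `σ` is reducible if `Φ(σ)` has a decomposition `Φ(u_1) ⊔ ⋯ ⊔ Φ(u_r)`, `r ≥ 1`, which is not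
trivial, that is, with `Φ(u_a) ≠ Φ(σ)` for all `a`. -/
def IsReducible {n : ℕ} (σ : Perm (Fin n)) : Prop :=
  ∃ (r : ℕ) (u : Fin r → Perm (Fin n)), 1 ≤ r ∧ IsDecomposition (invSet σ) u ∧
    ∀ a, invSet σ ≠ invSet (u a)

def IsIrreducible {n : ℕ} (σ : Perm (Fin n)) : Prop := ¬ IsReducible σ

/-- A block of `σ`: an interval (set of consecutive integers) whose image is again an interval. -/
def IsBlock {n : ℕ} (σ : Perm (Fin n)) (s : Finset (Fin n)) : Prop :=
  (s : Set (Fin n)).OrdConnected ∧ (σ '' (s : Set (Fin n))).OrdConnected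

/-- `σ` is simple if it has no block of size `t` with `1 < t < n`. -/
def IsSimple {n : ℕ} (σ : Perm (Fin n)) : Prop :=
  ∀ s : Finset (Fin n), IsBlock σ s → ¬ (1 < s.card ∧ s.card < n)

/-- The inflation `σ[β_1, …, β_m] ∈ S_n`.  The composition `c` of `n` records the (positive) sizes
`z_1, …, z_m` of the piles into which `1, …, n` is cut, in order; here `m = c.length` and
`z_b = c.blocksFun b`.  The pile `b` is shuffled by `β_b ∈ S_{z_b}`, and then the piles are put
together so that pile `b` becomes the pile number `σ(b)`: the `k`-th element of pile `b` is sent to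
`∑_{i < σ(b)} z_{σ⁻¹(i)} + β_b(k)`. -/
def inflate {n : ℕ} (c : Composition n) (σ : Perm (Fin c.length))
    (β : ∀ b : Fin c.length, Perm (Fin (c.blocksFun b))) : Perm (Fin n) :=
  c.blocksFinEquiv.symm.trans
    ((Equiv.sigmaCongr (β₂ := fun i => Fin (c.blocksFun (σ.symm i))) σ
        (fun b => (β b).trans (finCongr (by simp)))).trans
      (finSigmaFinEquiv.trans
        (finCongr ((Equiv.sum_comp σ.symm c.blocksFun).trans c.sum_blocksFun))))

/-- `w` is minus-decomposable if `w = w₀[α, β]` with `w₀ ∈ S_2` and two (non-empty) piles. -/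
def IsMinusDecomposable {n : ℕ} (w : Perm (Fin n)) : Prop :=
  ∃ (c : Composition n) (β : ∀ b : Fin c.length, Perm (Fin (c.blocksFun b))),
    c.length = 2 ∧ w = inflate c (w0 c.length) β

/-- The list `w_1, …, w_r` (with `r ≥ 1`) has the recursive form given by the data
`c`, `σ`, `β`, `q`:
* `w_a = σ_a[β_{a1}, …, β_{am}]` for all `a`, where `m = c.length` and `z_b = c.blocksFun b`;
* `Δ_{z_b}⁺ = Φ(β_{1b}) ⊔ ⋯ ⊔ Φ(β_{rb})` for all `b`;
* `σ_q = ⋯ = σ_r = Id`;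
* if `w_1` is minus-decomposable, then `m ≥ 2`, `σ_1 = w₀` and `q = 2`;
* if not, then `m ≥ 4`, `σ_1` is simple, `r ≥ 2`, `σ_2 = w₀ σ_1` and `q = 3`.
The list entry with number `a` in `1, …, r` is the one with index `a - 1` in `Fin r`. -/
structure IsRecursiveForm {n r : ℕ} (hr : 0 < r) (w : Fin r → Perm (Fin n))
    (c : Composition n) (σ : Fin r → Perm (Fin c.length))
    (β : Fin r → ∀ b : Fin c.length, Perm (Fin (c.blocksFun b))) (q : ℕ) : Prop where
  eq_inflate : ∀ a, w a = inflate c (σ a) (β a)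
  dagger : ∀ b, IsDecomposition (posRoots (c.blocksFun b)) (fun a => β a b)
  eq_id : ∀ a : Fin r, q ≤ a.val + 1 → σ a = 1
  minus_decomposable : IsMinusDecomposable (w ⟨0, hr⟩) →
    2 ≤ c.length ∧ σ ⟨0, hr⟩ = w0 c.length ∧ q = 2
  minus_indecomposable : ¬ IsMinusDecomposable (w ⟨0, hr⟩) →
    4 ≤ c.length ∧ IsSimple (σ ⟨0, hr⟩) ∧
      (∃ h : 1 < r, σ ⟨1, h⟩ = w0 c.length * σ ⟨0, hr⟩) ∧ q = 3

/-- The conditions on the data of a recursive form that characterize irreducibility: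
* the decompositions `Δ_{z_b}⁺ = Φ(β_{1b}) ⊔ ⋯ ⊔ Φ(β_{rb})` are irreducible;
* for each `a ≥ q`, exactly one of `β_{a1}, …, β_{am}` is not `Id`;
* if `w_1` is minus-decomposable, then `m = 2` and `β_{11} = Id`, `β_{12} = Id`;
* if not, then `β_{1b} = β_{2b} = Id` for all `b`. -/
structure IrreducibilityCriterion {n r : ℕ} (hr : 0 < r) (w : Fin r → Perm (Fin n))
    (c : Composition n) (β : Fin r → ∀ b : Fin c.length, Perm (Fin (c.blocksFun b)))
    (q : ℕ) : Prop where
  dagger_irreducible : ∀ b a, IsIrreducible (β a b)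
  exactly_one : ∀ a : Fin r, q ≤ a.val + 1 → ∃! b, β a b ≠ 1
  minus_decomposable : IsMinusDecomposable (w ⟨0, hr⟩) →
    c.length = 2 ∧ ∀ b, β ⟨0, hr⟩ b = 1
  minus_indecomposable : ¬ IsMinusDecomposable (w ⟨0, hr⟩) →
    ∀ b, β ⟨0, hr⟩ b = 1 ∧ ∃ h : 1 < r, β ⟨1, h⟩ b = 1

end InvDecomp

namespace InvDecomp

/-! ### Ordered Gallai colourings -/

/-! Colour a pair `i < j` by the index of the member whose inversion set contains it. If a
permutation inverts `(i, k)` and `i < j < k`, it inverts `(i, j)` or `(j, k)`; so the colour of `ik`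
is that of `ij` or of `jk`, an ordered Gallai colouring. Call a colour connected if an edge of that
colour crosses every cut of the interval of positions.

Two facts drive the proof. A colour that is used but not connected has a component that is a proper
interval with at least two points, seen in a single colour from each outside point: a common block
of all members (`exists_homogeneous_interval`). And three colours are never all connected
(`not_three_connected_colors`). So a decomposition of `Δ⁺` without common non-trivial block has at
most two non-identity members (`IsDecomposition.false_of_three_ne_one`).

If some member is minus-decomposable, its own two piles serve all members. Otherwise being in a
common proper block is an equivalence relation: two overlapping blocks have a block as union, and
proper ones cannot cover everything without making a member minus-decomposable. The quotient by it
has no common non-trivial block, hence exactly two non-identity members, complementary to each other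
and simple.

For irreducibility, the pairs inside piles and the pairs across piles of an inflation can be
decomposed independently. An irreducible inflation therefore lives in its quotient alone or in one
pile alone, and conversely such inflations inherit irreducibility from that quotient or pile. -/

theorem color_const_of_connected {κ : Type*} {f : ℕ → ℕ → κ} {m p q : ℕ} {a : κ}
    (hf : ∀ i j k, i < j → j < k → k < m → f i k = f i j ∨ f i k = f j k) (hq : q ≤ m)
    (hcut : ∀ k, p < k → k < q → ∃ i j, p ≤ i ∧ i < k ∧ k ≤ j ∧ j < q ∧ f i j = a)
    {α : Type*} (g : ℕ → α)
    (hg : ∀ i j, p ≤ i → i < j → j < q → f i j = a → g i = g j) :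
    ∀ x, p ≤ x → x < q → g x = g p := by
  intro x
  induction x using Nat.strong_induction_on with
  | _ x ih =>
    intro hpx hxq
    rcases hpx.eq_or_lt with rfl | hpx
    · rfl
    obtain ⟨i, j, hpi, hi, hj, hjq, hij⟩ := hcut x hpx hxq
    have h1 := ih i hi hpi (by omega)
    rcases hj.eq_or_lt with rfl | hj
    · rw [← h1, hg i x hpi hi hjq hij]
    -- The edge `ij` jumps over `x`, so `ix` or `xj` also has colour `a`; this joins `x` to `i`,
    -- directly or through `j`.
    · rcases hf i x j hi hj (by omega) with h | h
      · rw [← h1, hg i x hpi hi hxq (h ▸ hij)]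
      · rw [← h1, hg i j hpi (by omega) hjq hij, hg x j (by omega) hj hjq (h ▸ hij)]

/-- Among three colours of an ordered Gallai colouring, some colour misses a cut. -/
theorem not_three_connected_colors {κ : Type*} {f : ℕ → ℕ → κ} {a b c : κ}
    (hab : a ≠ b) (hac : a ≠ c) (hbc : b ≠ c) (m : ℕ) (hm : 2 ≤ m)
    (hf : ∀ i j k, i < j → j < k → k < m → f i k = f i j ∨ f i k = f j k) :
    ¬ ∀ d, d = a ∨ d = b ∨ d = c →
      ∀ k, 0 < k → k < m → ∃ i j, i < k ∧ k ≤ j ∧ j < m ∧ f i j = d := by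
  induction m, hm using Nat.le_induction with
  | base =>
    intro h
    obtain ⟨i, j, h1, h2, h3, h4⟩ := h a (by simp) 1 (by omega) (by omega)
    obtain ⟨i', j', h1', h2', h3', h4'⟩ := h b (by simp) 1 (by omega) (by omega)
    obtain rfl : i = 0 := by omega
    obtain rfl : i' = 0 := by omega
    obtain rfl : j = 1 := by omega
    obtain rfl : j' = 1 := by omega
    exact hab (h4.symm.trans h4')
  | succ m hm ih =>
    intro h
    have ih := ih (fun i j k h1 h2 h3 => hf i j k h1 h2 (by omega))
    classical
    push Not at ih
    obtain ⟨d, hd, hk⟩ := ih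
    have hmin := Nat.find_spec hk
    -- `k` is the first cut missed by `d` when the last vertex is dropped. By minimality `d` is
    -- connected on `[0, k)`, and only edges ending in the last vertex can carry `d` across `k`.
    set k := Nat.find hk with hkdef
    obtain ⟨hk0, hkm, hno⟩ := hmin
    have hcut : ∀ k', 0 < k' → k' < k →
        ∃ i j, 0 ≤ i ∧ i < k' ∧ k' ≤ j ∧ j < k ∧ f i j = d := by
      intro k' h0 hk'
      have h1 := Nat.find_min hk hk'
      push Not at h1
      obtain ⟨i, j, hi, hj, hjm, hij⟩ := h1 h0 (by omega)
      refine ⟨i, j, by omega, hi, hj, ?_, hij⟩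
      by_contra hjk
      exact hno i j (by omega) (by omega) hjm hij
    obtain ⟨x, j, hx, hj, hjm, hxj⟩ := h d hd k hk0 (by omega)
    obtain rfl : j = m := by
      by_contra hne
      exact hno x j hx hj (by omega) hxj
    have hY : ∀ y, k ≤ y → y < j → f y j = d := by
      intro y hy hyj
      rcases hf x y j (by omega) hyj (by omega) with h1 | h1
      · exact absurd (h1 ▸ hxj) (hno x y hx hy hyj)
      · exact h1 ▸ hxj
    -- No edge from `[0, k)` to `k` has colour `d`, so along a `d`-edge inside `[0, k)` the colour
    -- towards `k` cannot change.
    have hconst := color_const_of_connected (g := fun i => f i k) hf (by omega) hcut (by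
      intro i i' _ hii hi' hd'
      rcases hf i i' k hii hi' (by omega) with h1 | h1
      · exact absurd (h1.trans hd') (hno i k (by omega) le_rfl hkm)
      · exact h1)
    -- A colour other than `d` reaches the last vertex only from `[0, k)`, and then also appears on
    -- the edge to `k`. Two such colours would both equal `f 0 k`.
    have key : ∀ d', d' ≠ d → (d' = a ∨ d' = b ∨ d' = c) → f 0 k = d' := by
      intro d' hdd hd'
      obtain ⟨i, j', hi, hj, hj2, hij⟩ := h d' hd' j (by omega) (by omega)
      obtain rfl : j' = j := by omega
      have hik : i < k := by
        by_contra hik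
        exact hdd (hij.symm.trans (hY i (by omega) hi))
      rw [← hconst i (by omega) hik]
      rcases hf i k j' hik hkm (by omega) with h1 | h1
      · exact h1 ▸ hij
      · exact absurd (hij.symm.trans (h1.trans (hY k le_rfl hkm))) hdd
    rcases hd with rfl | rfl | rfl
    · exact hbc ((key b hab.symm (by simp)).symm.trans (key c hac.symm (by simp)))
    · exact hac ((key a hab (by simp)).symm.trans (key c hbc.symm (by simp)))
    · exact hab ((key a hac (by simp)).symm.trans (key b hbc (by simp)))

/-- A colour that is used but misses a cut has a component that is a non-trivial
homogeneous interval. -/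
theorem exists_homogeneous_interval {κ : Type*} {f : ℕ → ℕ → κ} {m : ℕ} {a : κ}
    (hf : ∀ i j k, i < j → j < k → k < m → f i k = f i j ∨ f i k = f j k)
    (hused : ∃ i j, i < j ∧ j < m ∧ f i j = a)
    (hcut : ∃ k, 0 < k ∧ k < m ∧ ∀ i j, i < k → k ≤ j → j < m → f i j ≠ a) :
    ∃ p q, p + 1 < q ∧ q ≤ m ∧ (0 < p ∨ q < m) ∧
      (∀ x y z, x < p → p ≤ y → y < q → p ≤ z → z < q → f x y = f x z) ∧
      (∀ x y z, q ≤ x → x < m → p ≤ y → y < q → p ≤ z → z < q → f y x = f z x) := by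
  classical
  obtain ⟨i₀, j₀, hij₀, hj₀, ha⟩ := hused
  obtain ⟨k, hk0, hkm, hk⟩ := hcut
  -- `E k` says that `a` misses the cut `k`; it holds vacuously at `0` and `m`, so `i₀` lies between
  -- two consecutive missed cuts.
  let E : ℕ → Prop := fun k => ∀ i j, i < k → k ≤ j → j < m → f i j ≠ a
  have hE0 : E 0 := fun i j h => by omega
  have hEm : E m := fun i j _ h h' => by omega
  -- the component of `i₀` is `[p, q)`
  have hq : ∃ q, i₀ < q ∧ E q := ⟨m, by omega, hEm⟩
  obtain ⟨hq1, hq2⟩ := Nat.find_spec hq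
  have hq3 := fun n => @Nat.find_min _ _ hq n
  have hqm : Nat.find hq ≤ m := Nat.find_min' hq ⟨by omega, hEm⟩
  set q := Nat.find hq
  have hp1 : Nat.findGreatest E i₀ ≤ i₀ := Nat.findGreatest_le _
  have hp2 : E (Nat.findGreatest E i₀) := Nat.findGreatest_spec (m := 0) (by omega) hE0
  have hp3 := fun n => @Nat.findGreatest_is_greatest n E _ i₀
  set p := Nat.findGreatest E i₀
  have hjq : j₀ < q := by
    by_contra h
    exact hq2 i₀ j₀ hq1 (by omega) hj₀ ha
  have hin : ∀ k, p < k → k < q → ∃ i j, p ≤ i ∧ i < k ∧ k ≤ j ∧ j < q ∧ f i j = a := by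
    intro k hpk hkq
    have hnE : ¬ E k := by
      intro hE
      by_cases h : k ≤ i₀
      · exact hp3 k hpk h hE
      · exact hq3 k hkq ⟨by omega, hE⟩
    simp only [E] at hnE
    push Not at hnE
    obtain ⟨i, j, hi, hj, hjm, hij⟩ := hnE
    refine ⟨i, j, ?_, hi, hj, ?_, hij⟩
    · by_contra h
      exact hp2 i j (by omega) (by omega) hjm hij
    · by_contra h
      exact hq2 i j (by omega) (by omega) hjm hij
  refine ⟨p, q, by omega, hqm, ?_, ?_, ?_⟩
  · by_contra hcon
    have hp0 : p = 0 := by omega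
    have hqm' : q = m := by omega
    obtain ⟨i, j, h1, h2, h3, h4, h5⟩ := hin k (by omega) (by omega)
    exact hk i j h2 h3 (by omega) h5
  · intro x y z hx hy hyq hz hzq
    have := color_const_of_connected (g := fun i => f x i) hf hqm hin (by
      intro i j hi hij hj hfa
      rcases hf x i j (by omega) hij (by omega) with h | h
      · exact h.symm
      · exact absurd (h.trans hfa) (hp2 x j hx (by omega) (by omega)))
    exact (this y hy hyq).trans (this z hz hzq).symm
  · intro x y z hx hxm hy hyq hz hzq
    have := color_const_of_connected (g := fun i => f i x) hf hqm hin (by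
      intro i j hi hij hj hfa
      rcases hf i j x hij (by omega) (by omega) with h | h
      · exact absurd (h.trans hfa) (hq2 i x (by omega) (by omega) (by omega))
      · exact h)
    exact (this y hy hyq).trans (this z hz hzq).symm

open Equiv

/-! ### Inversion sets -/

theorem mem_invSet {n : ℕ} {σ : Perm (Fin n)} {x y : Fin n} :
    (x, y) ∈ invSet σ ↔ x < y ∧ σ y < σ x := Iff.rfl

theorem mem_posRoots {n : ℕ} {x y : Fin n} : (x, y) ∈ posRoots n ↔ x < y := Iff.rfl

theorem w0_lt_iff {n : ℕ} {x y : Fin n} : w0 n x < w0 n y ↔ y < x := by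
  simp [w0]

theorem w0_mul_lt_iff {n : ℕ} {σ : Perm (Fin n)} {x y : Fin n} :
    (w0 n * σ) x < (w0 n * σ) y ↔ σ y < σ x := by
  rw [Perm.mul_apply, Perm.mul_apply, w0_lt_iff]

theorem w0_mul_w0_mul {n : ℕ} (σ : Perm (Fin n)) : w0 n * (w0 n * σ) = σ := by
  ext x
  simp [w0]

theorem perm_eq_of_lt_iff {n : ℕ} {σ τ : Perm (Fin n)} (h : ∀ x y, σ x < σ y ↔ τ x < τ y) :
    σ = τ := by
  have hm : StrictMono (τ * σ⁻¹) := by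
    intro x y hxy
    rw [Perm.mul_apply, Perm.mul_apply, ← h]
    simpa using hxy
  have h1 : τ * σ⁻¹ = 1 := by
    ext x
    have := Subsingleton.elim (hm.orderIsoOfSurjective _ (τ * σ⁻¹).surjective) (OrderIso.refl _)
    exact congrArg Fin.val (DFunLike.congr_fun this x)
  exact (mul_inv_eq_one.mp h1).symm

theorem invSet_injective {n : ℕ} : Function.Injective (invSet (n := n)) := by
  intro σ τ h
  have key : ∀ x y, x < y → (σ y < σ x ↔ τ y < τ x) := by
    intro x y hxy
    have := Set.ext_iff.mp h (x, y)
    simpa [mem_invSet, hxy] using this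
  refine perm_eq_of_lt_iff fun x y => ?_
  rcases lt_trichotomy x y with hxy | rfl | hxy
  · have h1 := key x y hxy
    have h2 : σ x ≠ σ y := fun h => hxy.ne (σ.injective h)
    have h3 : τ x ≠ τ y := fun h => hxy.ne (τ.injective h)
    rw [← not_iff_not, not_lt, not_lt, le_iff_lt_or_eq, le_iff_lt_or_eq, h1]
    simp [h2.symm, h3.symm]
  · simp
  · exact key y x hxy

theorem invSet_one (n : ℕ) : invSet (1 : Perm (Fin n)) = ∅ := by
  ext ⟨x, y⟩
  simpa [mem_invSet] using le_of_lt

theorem invSet_eq_empty {n : ℕ} {σ : Perm (Fin n)} : invSet σ = ∅ ↔ σ = 1 := by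
  rw [← invSet_one, invSet_injective.eq_iff]

theorem exists_mem_invSet {n : ℕ} {σ : Perm (Fin n)} (h : σ ≠ 1) : ∃ x y, (x, y) ∈ invSet σ := by
  obtain ⟨⟨x, y⟩, hxy⟩ := Set.nonempty_iff_ne_empty.mpr (mt invSet_eq_empty.mp h)
  exact ⟨x, y, hxy⟩

theorem mem_invSet_w0 {n : ℕ} {x y : Fin n} : (x, y) ∈ invSet (w0 n) ↔ x < y := by
  simp [mem_invSet, w0_lt_iff]

theorem mem_invSet_w0_mul {n : ℕ} {σ : Perm (Fin n)} {x y : Fin n} :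
    (x, y) ∈ invSet (w0 n * σ) ↔ x < y ∧ (x, y) ∉ invSet σ := by
  rw [mem_invSet, mem_invSet, w0_mul_lt_iff]
  refine and_congr_right fun h => ?_
  have h2 : σ x ≠ σ y := fun h' => h.ne (σ.injective h')
  simp [h, le_iff_lt_or_eq, h2]

/-- Inversion sets are co-closed; this is what turns a decomposition into an ordered Gallai
colouring. -/
theorem mem_invSet_or {n : ℕ} {σ : Perm (Fin n)} {x y z : Fin n} (hxy : x < y) (hyz : y < z)
    (h : (x, z) ∈ invSet σ) : (x, y) ∈ invSet σ ∨ (y, z) ∈ invSet σ := by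
  simp only [mem_invSet] at *
  rcases lt_or_ge (σ y) (σ x) with h1 | h1
  · exact Or.inl ⟨hxy, h1⟩
  · exact Or.inr ⟨hyz, h.2.trans_le h1⟩

theorem isDecomposition_iff {n r : ℕ} {S : Set (Fin n × Fin n)} {u : Fin r → Perm (Fin n)} :
    IsDecomposition S u ↔ (∀ x y, (x, y) ∈ S ↔ ∃ a, (x, y) ∈ invSet (u a)) ∧
      ∀ x y a a', (x, y) ∈ invSet (u a) → (x, y) ∈ invSet (u a') → a = a' := by
  constructor
  · rintro ⟨h1, h2⟩
    refine ⟨fun x y => by simp [h2], fun x y a a' h h' => ?_⟩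
    by_contra hne
    exact Set.disjoint_left.mp (h1 a a' hne) h h'
  · rintro ⟨h1, h2⟩
    refine ⟨fun a a' hne => Set.disjoint_left.mpr fun p h h' => hne (h2 p.1 p.2 a a' h h'), ?_⟩
    ext ⟨x, y⟩
    simp [h1]

/-! ### Patterns -/

/-- The permutation of `Fin m` whose values are ordered as those of the injection `g`. -/
def pattern {m n : ℕ} (g : Fin m → Fin n) : Perm (Fin m) := (Tuple.sort g)⁻¹

theorem pattern_lt_iff {m n : ℕ} {g : Fin m → Fin n} (hg : Function.Injective g) {i j : Fin m} :
    pattern g i < pattern g j ↔ g i < g j := by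
  have h : StrictMono (g ∘ Tuple.sort g) :=
    (Tuple.monotone_sort g).strictMono_of_injective (hg.comp (Tuple.sort g).injective)
  rw [← h.lt_iff_lt]
  simp [pattern]

theorem mem_invSet_pattern {m n : ℕ} {g : Fin m → Fin n} (hg : StrictMono g) {σ : Perm (Fin n)}
    {i j : Fin m} : (i, j) ∈ invSet (pattern (σ ∘ g)) ↔ (g i, g j) ∈ invSet σ := by
  rw [mem_invSet, mem_invSet, pattern_lt_iff (σ.injective.comp hg.injective), hg.lt_iff_lt]
  rfl

theorem IsDecomposition.pattern {m n r : ℕ} {g : Fin m → Fin n} (hg : StrictMono g)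
    {S : Set (Fin n × Fin n)} {T : Set (Fin m × Fin m)} {u : Fin r → Perm (Fin n)}
    (hu : IsDecomposition S u) (hT : ∀ i j, (i, j) ∈ T ↔ (g i, g j) ∈ S) :
    IsDecomposition T fun a => pattern (u a ∘ g) := by
  rw [isDecomposition_iff] at *
  simp only [mem_invSet_pattern hg, hT]
  exact ⟨fun i j => hu.1 _ _, fun i j => hu.2 _ _⟩

/-! ### Blocks -/

/-- Convexity of the image means that no outside value separates two values of `s`. This form uses
order comparisons only and passes easily to unions and quotients. -/
theorem isBlock_iff {n : ℕ} {σ : Perm (Fin n)} {s : Finset (Fin n)} :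
    IsBlock σ s ↔ (s : Set (Fin n)).OrdConnected ∧
      ∀ x y z, x ∉ s → y ∈ s → z ∈ s → (σ x < σ y ↔ σ x < σ z) := by
  refine and_congr_right fun _ => ⟨fun h => ?_, fun h => ?_⟩
  · have key : ∀ x y z, x ∉ s → y ∈ s → z ∈ s → σ x < σ y → σ x < σ z := by
      intro x y z hx hy hz hxy
      by_contra hxz
      obtain ⟨x', hx', he⟩ := h.out (Set.mem_image_of_mem σ hz) (Set.mem_image_of_mem σ hy)
        ⟨not_lt.mp hxz, hxy.le⟩
      exact hx (σ.injective he ▸ hx')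
    exact fun x y z hx hy hz => ⟨key x y z hx hy hz, key x z y hx hz hy⟩
  · refine ⟨?_⟩
    rintro _ ⟨y, hy, rfl⟩ _ ⟨z, hz, rfl⟩ t ⟨h1, h2⟩
    obtain ⟨x, rfl⟩ := σ.surjective t
    by_contra hx
    have hxs : x ∉ s := fun hxs => hx ⟨x, hxs, rfl⟩
    have hne : σ x ≠ σ z := fun h => hxs (by rw [σ.injective h]; exact hz)
    exact h1.not_gt ((h x y z hxs hy hz).mpr (lt_of_le_of_ne h2 hne))

theorem IsBlock.lt_iff {n : ℕ} {σ : Perm (Fin n)} {s : Finset (Fin n)} (h : IsBlock σ s)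
    {x y z : Fin n} (hx : x ∉ s) (hy : y ∈ s) (hz : z ∈ s) : σ y < σ x ↔ σ z < σ x := by
  have h1 := (isBlock_iff.mp h).2 x y z hx hy hz
  have hy' : σ y ≠ σ x := fun h => hx (σ.injective h ▸ hy)
  have hz' : σ z ≠ σ x := fun h => hx (σ.injective h ▸ hz)
  rw [← not_iff_not, not_lt, not_lt, le_iff_lt_or_eq, le_iff_lt_or_eq, h1]
  simp [hy'.symm, hz'.symm]

/-- Blocks from inversion sets. -/
theorem isBlock_of_invSet {n : ℕ} {σ : Perm (Fin n)} {s : Finset (Fin n)}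
    (hs : (s : Set (Fin n)).OrdConnected)
    (h : ∀ x y z, x ∉ s → y ∈ s → z ∈ s →
      ((x, y) ∈ invSet σ → (x, z) ∈ invSet σ) ∧ ((y, x) ∈ invSet σ → (z, x) ∈ invSet σ)) :
    IsBlock σ s := by
  have side : ∀ x y z, x ∉ s → y ∈ s → z ∈ s → x < y → x < z := by
    intro x y z hx hy hz hxy
    by_contra hxz
    exact hx (hs.out hz hy ⟨not_lt.mp hxz, hxy.le⟩)
  have key : ∀ x y z, x ∉ s → y ∈ s → z ∈ s → σ x < σ y → σ x < σ z := by
    intro x y z hx hy hz hxy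
    have hne : x ≠ y := fun h => hx (h ▸ hy)
    have hne' : x ≠ z := fun h => hx (h ▸ hz)
    rcases hne.lt_or_gt with hlt | hlt
    · by_contra hxz
      have hxz' : σ z < σ x :=
        lt_of_le_of_ne (not_lt.mp hxz) fun h => hne' (σ.injective h).symm
      exact hxy.not_gt ((h x z y hx hz hy).1 ⟨side x y z hx hy hz hlt, hxz'⟩).2
    · exact ((h x y z hx hy hz).2 ⟨hlt, hxy⟩).2
  exact isBlock_iff.mpr ⟨hs, fun x y z hx hy hz => ⟨key x y z hx hy hz, key x z y hx hz hy⟩⟩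

theorem isBlock_one {n : ℕ} {s : Finset (Fin n)} (hs : (s : Set (Fin n)).OrdConnected) :
    IsBlock (1 : Perm (Fin n)) s := ⟨hs, by simpa using hs⟩

theorem IsBlock.w0_mul {n : ℕ} {σ : Perm (Fin n)} {s : Finset (Fin n)} (h : IsBlock σ s) :
    IsBlock (w0 n * σ) s := by
  refine isBlock_iff.mpr ⟨h.1, fun x y z hx hy hz => ?_⟩
  rw [w0_mul_lt_iff, w0_mul_lt_iff, h.lt_iff hx hy hz]

theorem IsSimple.w0_mul {n : ℕ} {σ : Perm (Fin n)} (h : IsSimple σ) : IsSimple (w0 n * σ) :=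
  fun s hs => h s (by simpa only [w0_mul_w0_mul] using hs.w0_mul)

theorem ordConnected_pair {n : ℕ} {i j : Fin n} (hij : j.val = i.val + 1) :
    (({i, j} : Finset (Fin n)) : Set (Fin n)).OrdConnected := by
  refine ⟨fun x hx y hy z hz => ?_⟩
  simp only [Finset.coe_insert, Finset.coe_singleton, Set.mem_insert_iff,
    Set.mem_singleton_iff, Set.mem_Icc, Fin.ext_iff, Fin.le_def] at *
  omega

theorem IsSimple.ne_one {n : ℕ} {σ : Perm (Fin n)} (hn : 3 ≤ n) (h : IsSimple σ) : σ ≠ 1 := by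
  rintro rfl
  have h1 := h {⟨0, by omega⟩, ⟨1, by omega⟩} (isBlock_one (ordConnected_pair rfl))
  rw [Finset.card_pair (by simp)] at h1
  omega

/-- Two neighbouring positions fail to be a block only if the third value lies between theirs. Both
outer values would have to be the median. This excludes `m = 3` in the simple case. -/
theorem not_isSimple_three {n : ℕ} (hn : n = 3) (σ : Perm (Fin n)) : ¬ IsSimple σ := by
  subst hn
  intro h
  have hb : ∀ i j k : Fin 3, j.val = i.val + 1 → k ≠ i → k ≠ j → ¬ (σ k < σ i ↔ σ k < σ j) := by
    intro i j k hij hki hkj hiff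
    have h1 := h {i, j} (isBlock_iff.mpr ⟨ordConnected_pair hij, fun x y z hx hy hz => ?_⟩)
    · rw [Finset.card_pair (by simp [Fin.ext_iff]; omega)] at h1
      omega
    · have hxk : x = k := by
        simp only [Finset.mem_insert, Finset.mem_singleton, Fin.ext_iff, ne_eq] at *
        omega
      subst hxk
      simp only [Finset.mem_insert, Finset.mem_singleton] at hy hz
      rcases hy with rfl | rfl <;> rcases hz with rfl | rfl <;> simp [hiff]
  have h1 := hb 0 1 2 rfl (by decide) (by decide)
  have h2 := hb 1 2 0 rfl (by decide) (by decide)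
  have n1 : σ 0 ≠ σ 1 := fun h => absurd (σ.injective h) (by decide)
  have n2 : σ 0 ≠ σ 2 := fun h => absurd (σ.injective h) (by decide)
  have n3 : σ 1 ≠ σ 2 := fun h => absurd (σ.injective h) (by decide)
  omega

/-! ### Prime decompositions -/

/-- A decomposition of `Δ⁺` whose members have no common non-trivial block involves at most two
non-identity permutations. -/
theorem IsDecomposition.false_of_three_ne_one {m r : ℕ} {τ : Fin r → Perm (Fin m)}
    (hτ : IsDecomposition (posRoots m) τ)
    (hprime : ∀ s : Finset (Fin m), (∀ a, IsBlock (τ a) s) → ¬ (1 < s.card ∧ s.card < m))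
    {a b c : Fin r} (hab : a ≠ b) (hac : a ≠ c) (hbc : b ≠ c)
    (ha : τ a ≠ 1) (hb : τ b ≠ 1) (hc : τ c ≠ 1) : False := by
  rw [isDecomposition_iff] at hτ
  obtain ⟨hex, huniq⟩ := hτ
  have hcol : ∀ i j : ℕ, ∃ d : Fin r, ∀ (hi : i < m) (hj : j < m), i < j →
      ((⟨i, hi⟩, ⟨j, hj⟩) : Fin m × Fin m) ∈ invSet (τ d) := by
    intro i j
    by_cases h : i < m ∧ j < m ∧ i < j
    · obtain ⟨d, hd⟩ := (hex ⟨i, h.1⟩ ⟨j, h.2.1⟩).mp h.2.2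
      exact ⟨d, fun _ _ _ => hd⟩
    -- Outside the triangle `i < j < m` the colour is a junk value.
    · exact ⟨a, fun hi hj hij => absurd ⟨hi, hj, hij⟩ h⟩
  choose f hf using hcol
  have hfd : ∀ (x y : Fin m) d, (x, y) ∈ invSet (τ d) → f x y = d := fun x y d h =>
    huniq x y _ _ (hf x y x.2 y.2 h.1) h
  have hdf : ∀ (x y : Fin m) d, x < y → f x y = d → (x, y) ∈ invSet (τ d) := fun x y d h e =>
    e ▸ hf x y x.2 y.2 h
  have hgallai : ∀ i j k, i < j → j < k → k < m → f i k = f i j ∨ f i k = f j k := by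
    intro i j k hij hjk hk
    have := mem_invSet_or (x := ⟨i, by omega⟩) (y := ⟨j, by omega⟩) (z := ⟨k, hk⟩) hij hjk
      (hf i k (by omega) hk (by omega))
    exact this.imp (fun h => (hfd _ _ _ h).symm) (fun h => (hfd _ _ _ h).symm)
  have hconn : ∀ d, τ d ≠ 1 →
      ∀ k, 0 < k → k < m → ∃ i j, i < k ∧ k ≤ j ∧ j < m ∧ f i j = d := by
    intro d hd
    by_contra hcon
    push Not at hcon
    obtain ⟨x, y, hxy⟩ := exists_mem_invSet hd
    obtain ⟨p, q, hpq, hqm, hproper, hl, hr⟩ := exists_homogeneous_interval hgallai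
      ⟨x, y, hxy.1, y.2, hfd _ _ _ hxy⟩ hcon
    have hmem : ∀ z : Fin m, z ∈ Finset.univ.filter (fun z : Fin m => p ≤ z.val ∧ z.val < q) ↔
        p ≤ z.val ∧ z.val < q := by simp
    -- The homogeneous interval `[p, q)` is a block of every member at once.
    refine hprime (Finset.univ.filter fun z : Fin m => p ≤ z.val ∧ z.val < q) (fun d => ?_) ⟨?_, ?_⟩
    · refine isBlock_of_invSet ⟨fun x hx y hy z hz => ?_⟩ fun x y z hx hy hz => ?_
      · simp only [Finset.coe_filter, Finset.mem_univ, true_and, Set.mem_ofPred_eq, Set.mem_Icc,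
          Fin.le_def] at *
        omega
      · rw [hmem] at hx hy hz
        constructor
        · intro h
          have h1 : x.val < y.val := h.1
          exact hdf _ _ _ (by rw [Fin.lt_def]; omega)
            ((hl x y z (by omega) hy.1 hy.2 hz.1 hz.2).symm.trans (hfd _ _ _ h))
        · intro h
          have h1 : y.val < x.val := h.1
          exact hdf _ _ _ (by rw [Fin.lt_def]; omega)
            ((hr x y z (by omega) x.2 hy.1 hy.2 hz.1 hz.2).symm.trans (hfd _ _ _ h))
    · rw [Finset.one_lt_card]
      exact ⟨⟨p, by omega⟩, by simp; omega, ⟨p + 1, by omega⟩, by simp; omega, by simp⟩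
    · have : Finset.univ.filter (fun z : Fin m => p ≤ z.val ∧ z.val < q) ⊂ Finset.univ := by
        rw [Finset.ssubset_univ_iff]
        intro h
        have h0 := (hmem ⟨0, by omega⟩).mp (h ▸ Finset.mem_univ _)
        have h1 := (hmem ⟨m - 1, by omega⟩).mp (h ▸ Finset.mem_univ _)
        simp only at h0 h1
        omega
      simpa using Finset.card_lt_card this
  obtain ⟨x, y, hxy⟩ := exists_mem_invSet ha
  have hm : 2 ≤ m := by
    have h1 : x.val < y.val := hxy.1
    have h2 := y.2
    omega
  refine not_three_connected_colors hab hac hbc m hm hgallai fun d hd => hconn d ?_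
  rcases hd with rfl | rfl | rfl <;> assumption

/-- Adding `w0 m * σ`, whose inversions are the non-inversions of `σ`, completes a decomposition of
`Φ(σ)` to one of `Δ⁺`. It has no common non-trivial block because `w0 m * σ` is simple, so besides
that permutation at most one member is not the identity. -/
theorem IsSimple.isIrreducible {m : ℕ} {σ : Perm (Fin m)} (hm : 3 ≤ m) (hσ : IsSimple σ) :
    IsIrreducible σ := by
  rintro ⟨r, u, -, hu, hne⟩
  rw [isDecomposition_iff] at hu
  obtain ⟨hex, huniq⟩ := hu
  have hdec : IsDecomposition (posRoots m) (Fin.cons (w0 m * σ) u : Fin (r + 1) → _) := by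
    rw [isDecomposition_iff]
    constructor
    · intro x y
      rw [mem_posRoots, Fin.exists_fin_succ]
      simp only [Fin.cons_zero, Fin.cons_succ, mem_invSet_w0_mul, ← hex]
      constructor
      · intro h
        by_cases h' : (x, y) ∈ invSet σ <;> simp [h, h']
      · rintro (h | h)
        exacts [h.1, h.1]
    · intro x y a a' h h'
      induction a using Fin.cases with
      | zero =>
        induction a' using Fin.cases with
        | zero => rfl
        | succ a' => exact absurd ((hex x y).mpr ⟨a', h'⟩) (mem_invSet_w0_mul.mp h).2
      | succ a =>
        induction a' using Fin.cases with
        | zero => exact absurd ((hex x y).mpr ⟨a, h⟩) (mem_invSet_w0_mul.mp h').2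
        | succ a' => rw [huniq x y a a' h h']
  have hprime : ∀ s : Finset (Fin m), (∀ a, IsBlock ((Fin.cons (w0 m * σ) u : Fin (r + 1) → _) a) s)
      → ¬ (1 < s.card ∧ s.card < m) := fun s hs => hσ.w0_mul s (hs 0)
  obtain ⟨x, y, hxy⟩ := exists_mem_invSet (hσ.ne_one hm)
  obtain ⟨a, ha⟩ := (hex x y).mp hxy
  have hua : u a ≠ 1 := fun h => by simp [h, invSet_one] at ha
  refine hne a (Set.ext fun p => ⟨fun h => ?_, fun h => (hex p.1 p.2).mpr ⟨a, h⟩⟩)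
  obtain ⟨a', ha'⟩ := (hex p.1 p.2).mp h
  have hua' : u a' ≠ 1 := fun h => by simp [h, invSet_one] at ha'
  obtain rfl : a = a' := by
    by_contra hne'
    exact hdec.false_of_three_ne_one hprime (a := 0) (b := a.succ) (c := a'.succ)
      (Fin.succ_ne_zero _).symm (Fin.succ_ne_zero _).symm (by simpa using hne')
      (hσ.w0_mul.ne_one hm) (by simpa using hua) (by simpa using hua')
  exact ha'

theorem isIrreducible_w0_two {m : ℕ} (hm : m = 2) : IsIrreducible (w0 m) := by
  subst hm
  rintro ⟨r, u, -, hu, hne⟩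
  rw [isDecomposition_iff] at hu
  have h2 : ∀ x y : Fin 2, x < y → x = 0 ∧ y = 1 := by decide
  obtain ⟨a, ha⟩ := (hu.1 0 1).mp (mem_invSet_w0.mpr (by decide))
  refine hne a (Set.ext fun p => ⟨fun h => ?_, fun h => (hu.1 p.1 p.2).mpr ⟨a, h⟩⟩)
  obtain ⟨h0, h1⟩ := h2 _ _ (mem_invSet_w0.mp h)
  rwa [← h0, ← h1] at ha

/-! ### Inflations -/

section Inflation

theorem sum_castLE_add_lt {m : ℕ} (z : Fin m → ℕ) {i j : Fin m} (hij : i < j) {k : ℕ}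
    (hk : k < z i) :
    ∑ l : Fin i, z (Fin.castLE i.2.le l) + k < ∑ l : Fin j, z (Fin.castLE j.2.le l) := by
  -- Extending the sizes by zero turns the sums over `Fin i` into sums over ranges, which can be
  -- compared by inclusion.
  let N : ℕ → ℕ := fun l => if h : l < m then z ⟨l, h⟩ else 0
  have h : ∀ i : Fin m, ∑ l : Fin i, z (Fin.castLE i.2.le l) = ∑ l ∈ Finset.range i, N l := by
    intro i
    rw [← Fin.sum_univ_eq_sum_range]
    refine Finset.sum_congr rfl fun l _ => ?_
    have hl : (l : ℕ) < m := l.2.trans i.2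
    simp only [N, hl, dite_true]
    rfl
  have hN : N i = z i := by simp [N]
  rw [h, h]
  calc _ < ∑ l ∈ Finset.range i, N l + N i := by omega
    _ = ∑ l ∈ Finset.range (i + 1), N l := (Finset.sum_range_succ _ _).symm
    _ ≤ _ := Finset.sum_le_sum_of_subset (Finset.range_subset_range.mpr hij)

variable {n : ℕ} {c : Composition n}

theorem val_inflate_embedding (σ : Perm (Fin c.length))
    (β : ∀ b : Fin c.length, Perm (Fin (c.blocksFun b))) (b : Fin c.length)
    (k : Fin (c.blocksFun b)) :
    (inflate c σ β (c.embedding b k) : ℕ) =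
      ∑ l : Fin (σ b), c.blocksFun (σ.symm (Fin.castLE (σ b).2.le l)) + β b k := by
  have h : c.blocksFinEquiv.symm (c.embedding b k) = ⟨b, k⟩ :=
    c.blocksFinEquiv.symm_apply_apply ⟨b, k⟩
  simp only [inflate, Equiv.trans_apply, h, finCongr_apply, Fin.val_cast, finSigmaFinEquiv_apply]
  rfl

theorem inflate_lt_of_same (σ : Perm (Fin c.length))
    (β : ∀ b : Fin c.length, Perm (Fin (c.blocksFun b))) (b : Fin c.length)
    (k k' : Fin (c.blocksFun b)) :
    inflate c σ β (c.embedding b k) < inflate c σ β (c.embedding b k') ↔ β b k < β b k' := by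
  rw [Fin.lt_def, Fin.lt_def, val_inflate_embedding, val_inflate_embedding]
  omega

theorem inflate_lt_of_ne (σ : Perm (Fin c.length))
    (β : ∀ b : Fin c.length, Perm (Fin (c.blocksFun b))) {b b' : Fin c.length} (hb : b ≠ b')
    (k : Fin (c.blocksFun b)) (k' : Fin (c.blocksFun b')) :
    inflate c σ β (c.embedding b k) < inflate c σ β (c.embedding b' k') ↔ σ b < σ b' := by
  have key : ∀ {b b' : Fin c.length} (k : Fin (c.blocksFun b)) (k' : Fin (c.blocksFun b')),
      σ b < σ b' → inflate c σ β (c.embedding b k) < inflate c σ β (c.embedding b' k') := by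
    intro b b' k k' h
    rw [Fin.lt_def, val_inflate_embedding, val_inflate_embedding]
    refine (sum_castLE_add_lt (fun l => c.blocksFun (σ.symm l)) h ?_).trans_le
      (Nat.le_add_right _ _)
    simp
  refine ⟨fun h => ?_, key k k'⟩
  by_contra hlt
  have hne : σ b' ≠ σ b := fun h => hb (σ.injective h).symm
  exact h.not_gt (key k' k (lt_of_le_of_ne (not_lt.mp hlt) hne))

theorem exists_eq_embedding (c : Composition n) (x : Fin n) : ∃ b k, x = c.embedding b k :=
  ⟨_, _, (c.embedding_comp_inv x).symm⟩

theorem embedding_lt_of_ne (c : Composition n) {b b' : Fin c.length} (hb : b ≠ b')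
    (k : Fin (c.blocksFun b)) (k' : Fin (c.blocksFun b')) :
    c.embedding b k < c.embedding b' k' ↔ b < b' := by
  have key : ∀ {b b' : Fin c.length} (k : Fin (c.blocksFun b)) (k' : Fin (c.blocksFun b')),
      b < b' → c.embedding b k < c.embedding b' k' := by
    intro b b' k k' h
    rw [Fin.lt_def, Composition.coe_embedding, Composition.coe_embedding]
    have h1 := c.monotone_sizeUpTo (show (b : ℕ) + 1 ≤ b' from h)
    rw [c.sizeUpTo_succ'] at h1
    omega
  refine ⟨fun h => ?_, key k k'⟩
  by_contra hlt
  exact h.not_gt (key k' k (lt_of_le_of_ne (not_lt.mp hlt) hb.symm))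

/-- A permutation is determined by its order comparisons, and these are either within a pile or
across two piles. With this criterion the explicit formula for values is no longer needed. -/
theorem eq_inflate_iff {w : Perm (Fin n)} {σ : Perm (Fin c.length)}
    {β : ∀ b : Fin c.length, Perm (Fin (c.blocksFun b))} :
    w = inflate c σ β ↔
      (∀ b k k', w (c.embedding b k) < w (c.embedding b k') ↔ β b k < β b k') ∧
      ∀ b b' k k', b ≠ b' → (w (c.embedding b k) < w (c.embedding b' k') ↔ σ b < σ b') := by
  constructor
  · rintro rfl
    exact ⟨inflate_lt_of_same σ β, fun b b' k k' hb => inflate_lt_of_ne σ β hb k k'⟩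
  · rintro ⟨h1, h2⟩
    refine perm_eq_of_lt_iff fun x y => ?_
    obtain ⟨b, k, rfl⟩ := exists_eq_embedding c x
    obtain ⟨b', k', rfl⟩ := exists_eq_embedding c y
    by_cases hb : b = b'
    · subst hb
      rw [h1, inflate_lt_of_same]
    · rw [h2 b b' k k' hb, inflate_lt_of_ne σ β hb]

/-- Piles are non-empty, so the quotient can be read off from one representative of each. -/
theorem inflate_injective {σ σ' : Perm (Fin c.length)}
    {β β' : ∀ b : Fin c.length, Perm (Fin (c.blocksFun b))}
    (h : inflate c σ β = inflate c σ' β') : σ = σ' ∧ β = β' := by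
  obtain ⟨h1, h2⟩ := eq_inflate_iff.mp h
  constructor
  · refine perm_eq_of_lt_iff fun b b' => ?_
    by_cases hb : b = b'
    · simp [hb]
    · let k : ∀ b : Fin c.length, Fin (c.blocksFun b) := fun b => ⟨0, c.one_le_blocksFun b⟩
      rw [← h2 b b' (k b) (k b') hb, inflate_lt_of_ne _ _ hb]
  · funext b
    refine perm_eq_of_lt_iff fun k k' => ?_
    rw [← h1, inflate_lt_of_same]

theorem inflate_one (c : Composition n) : inflate c 1 (fun _ => 1) = 1 := by
  refine (eq_inflate_iff.mpr ⟨fun b k k' => ?_, fun b b' k k' hb => ?_⟩).symm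
  · simp
  · simpa using embedding_lt_of_ne c hb k k'

theorem mem_invSet_inflate_same (σ : Perm (Fin c.length))
    (β : ∀ b : Fin c.length, Perm (Fin (c.blocksFun b))) (b : Fin c.length)
    (k k' : Fin (c.blocksFun b)) :
    (c.embedding b k, c.embedding b k') ∈ invSet (inflate c σ β) ↔ (k, k') ∈ invSet (β b) := by
  rw [mem_invSet, mem_invSet, inflate_lt_of_same, (c.embedding b).lt_iff_lt]

theorem mem_invSet_inflate_of_ne (σ : Perm (Fin c.length))
    (β : ∀ b : Fin c.length, Perm (Fin (c.blocksFun b))) {b b' : Fin c.length} (hb : b ≠ b')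
    (k : Fin (c.blocksFun b)) (k' : Fin (c.blocksFun b')) :
    (c.embedding b k, c.embedding b' k') ∈ invSet (inflate c σ β) ↔ (b, b') ∈ invSet σ := by
  rw [mem_invSet, mem_invSet, inflate_lt_of_ne _ _ hb.symm, embedding_lt_of_ne c hb]

theorem IsDecomposition.inflate {r : ℕ} {σ : Perm (Fin c.length)}
    {β : ∀ b : Fin c.length, Perm (Fin (c.blocksFun b))} {τ : Fin r → Perm (Fin c.length)}
    {γ : Fin r → ∀ b : Fin c.length, Perm (Fin (c.blocksFun b))}
    (hσ : IsDecomposition (invSet σ) τ)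
    (hβ : ∀ b, IsDecomposition (invSet (β b)) fun a => γ a b) :
    IsDecomposition (invSet (inflate c σ β)) fun a => inflate c (τ a) (γ a) := by
  simp only [isDecomposition_iff] at *
  constructor
  · intro x y
    obtain ⟨b, k, rfl⟩ := exists_eq_embedding c x
    obtain ⟨b', k', rfl⟩ := exists_eq_embedding c y
    by_cases hb : b = b'
    · subst hb
      simp only [mem_invSet_inflate_same]
      exact (hβ b).1 k k'
    · simp only [mem_invSet_inflate_of_ne _ _ hb]
      exact hσ.1 b b'
  · intro x y
    obtain ⟨b, k, rfl⟩ := exists_eq_embedding c x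
    obtain ⟨b', k', rfl⟩ := exists_eq_embedding c y
    by_cases hb : b = b'
    · subst hb
      simp only [mem_invSet_inflate_same]
      exact (hβ b).2 k k'
    · simp only [mem_invSet_inflate_of_ne _ _ hb]
      exact hσ.2 b b'

/-! ### Irreducibility of inflations -/

theorem isDecomposition_one {m r : ℕ} : IsDecomposition (invSet (1 : Perm (Fin m)))
    fun _ : Fin r => 1 := by
  simp [isDecomposition_iff, invSet_one]

/-- A decomposition with one permutation in a single place. -/
theorem isDecomposition_single {m r : ℕ} {σ : Perm (Fin m)} {u : Fin r → Perm (Fin m)} (a : Fin r)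
    (ha : u a = σ) (hu : ∀ a', a' ≠ a → u a' = 1) : IsDecomposition (invSet σ) u := by
  have key : ∀ x y a', (x, y) ∈ invSet (u a') → a' = a := by
    intro x y a' h
    by_contra hne
    simp [hu a' hne, invSet_one] at h
  rw [isDecomposition_iff]
  refine ⟨fun x y => ⟨fun h => ⟨a, by rwa [ha]⟩, ?_⟩, fun x y a' a'' h h' =>
    (key x y a' h).trans (key x y a'' h').symm⟩
  rintro ⟨a', h⟩
  obtain rfl := key x y a' h
  rwa [← ha]

/-- The members of a decomposition of an irreducible inversion set are trivial. -/
theorem IsIrreducible.exists_eq {m r : ℕ} {σ : Perm (Fin m)} (hσ : IsIrreducible σ)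
    {u : Fin r → Perm (Fin m)} (hr : 1 ≤ r) (hu : IsDecomposition (invSet σ) u) :
    ∃ a, u a = σ := by
  by_contra hne
  push Not at hne
  exact hσ ⟨r, u, hr, hu, fun a h => hne a (invSet_injective h).symm⟩

theorem isIrreducible_iff {m : ℕ} {σ : Perm (Fin m)} : IsIrreducible σ ↔
    ∀ (r : ℕ) (u : Fin r → Perm (Fin m)), 1 ≤ r → IsDecomposition (invSet σ) u →
      ∃ a, u a = σ := by
  refine ⟨fun h r u hr hu => h.exists_eq hr hu, fun h => ?_⟩
  rintro ⟨r, u, hr, hu, hne⟩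
  obtain ⟨a, ha⟩ := h r u hr hu
  exact hne a (by rw [ha])

/-- A decomposition of `Φ(β b)` extends to one of the whole inflation by assigning the quotient and
all other piles to the first member. -/
theorem isIrreducible_pile {σ : Perm (Fin c.length)}
    {β : ∀ b : Fin c.length, Perm (Fin (c.blocksFun b))} (h : IsIrreducible (inflate c σ β))
    (b : Fin c.length) : IsIrreducible (β b) := by
  rw [isIrreducible_iff]
  intro r u hr hu
  let i₀ : Fin r := ⟨0, hr⟩
  obtain ⟨a, ha⟩ := h.exists_eq (r := r) hr (IsDecomposition.inflate
    (τ := fun i => if i = i₀ then σ else 1)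
    (γ := fun i => Function.update (if i = i₀ then β else fun _ => 1) b (u i))
    (isDecomposition_single i₀ (by simp) (fun a' ha' => by simp [ha'])) (fun b' => by
      by_cases hb : b' = b
      · subst hb
        simpa using hu
      · refine isDecomposition_single i₀ (by simp [hb]) fun a' ha' => by simp [hb, ha']))
  refine ⟨a, ?_⟩
  simpa using congrFun (inflate_injective ha).2 b

theorem isIrreducible_quotient {σ : Perm (Fin c.length)}
    (h : IsIrreducible (inflate c σ fun _ => 1)) : IsIrreducible σ := by
  rw [isIrreducible_iff]
  intro r u hr hu
  obtain ⟨a, ha⟩ := h.exists_eq hr (hu.inflate (γ := fun _ _ => 1) fun b => isDecomposition_one)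
  exact ⟨a, (inflate_injective ha).1⟩

/-- An irreducible inflation comes either from the quotient or from a single pile. -/
theorem IsIrreducible.inflate_cases {σ : Perm (Fin c.length)}
    {β : ∀ b : Fin c.length, Perm (Fin (c.blocksFun b))} (h : IsIrreducible (inflate c σ β)) :
    (∀ b, β b = 1) ∨ σ = 1 ∧ ∃ b, ∀ b', b' ≠ b → β b' = 1 := by
  obtain ⟨a, ha⟩ := h.exists_eq (r := c.length + 1) (by omega) (IsDecomposition.inflate
    (τ := fun i => if i = 0 then σ else 1)
    (γ := fun i b => if i = b.succ then β b else 1)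
    (isDecomposition_single 0 (by simp) fun a' ha' => by simp [ha']) fun b =>
      isDecomposition_single b.succ (by simp) fun a' ha' => by simp [ha'])
  obtain ⟨h1, h2⟩ := inflate_injective ha
  induction a using Fin.cases with
  | zero =>
    refine Or.inl fun b => ?_
    rw [← h2]
    simp [(Fin.succ_ne_zero b).symm]
  | succ a =>
    refine Or.inr ⟨by simpa using h1.symm, a, fun b' hb' => ?_⟩
    rw [← h2]
    simp [hb'.symm]

/-- No member of a decomposition inverts a pair inside a pile, so co-closedness forces all pairs
across two given piles into the same member. Everything is then determined by the first elements of
the piles, where the decomposition is one of `Φ(σ)`. -/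
theorem isIrreducible_inflate_one {σ : Perm (Fin c.length)} (hσ : IsIrreducible σ) :
    IsIrreducible (inflate c σ fun _ => 1) := by
  rw [isIrreducible_iff]
  intro r u hr hu
  let g : Fin c.length → Fin n := fun b => c.embedding b ⟨0, c.one_le_blocksFun b⟩
  have hg : StrictMono g := fun b b' h => (embedding_lt_of_ne c h.ne _ _).mpr h
  obtain ⟨a, ha⟩ := hσ.exists_eq hr (hu.pattern hg fun i j => by
    by_cases hij : i = j
    · subst hij
      simp [mem_invSet]
    · rw [mem_invSet_inflate_of_ne _ _ hij])
  have hout := (isDecomposition_iff.mp hu).1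
  have huniq := (isDecomposition_iff.mp hu).2
  have hnot : ∀ b k k' d, (c.embedding b k, c.embedding b k') ∉ invSet (u d) := by
    intro b k k' d h
    have := (hout _ _).mpr ⟨d, h⟩
    simp [mem_invSet_inflate_same, invSet_one] at this
  have hleft : ∀ b b' k k' l d, b ≠ b' →
      (c.embedding b k, c.embedding b' l) ∈ invSet (u d) →
      (c.embedding b k', c.embedding b' l) ∈ invSet (u d) := by
    intro b b' k k' l d hb h
    have hlt : b < b' := (embedding_lt_of_ne c hb _ _).mp h.1
    rcases lt_trichotomy k k' with hk | rfl | hk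
    · exact (mem_invSet_or ((c.embedding b).lt_iff_lt.mpr hk)
        ((embedding_lt_of_ne c hb _ _).mpr hlt) h).resolve_left (hnot _ _ _ _)
    · exact h
    -- Co-closedness only moves a pair inwards. For the outward move, the target pair lies in some
    -- member `d'`; moving it inwards gives the original pair, so `d' = d`.
    · obtain ⟨d', hd'⟩ := (hout (c.embedding b k') (c.embedding b' l)).mp (by
        have := (hout _ _).mpr ⟨d, h⟩
        rw [mem_invSet_inflate_of_ne _ _ hb] at this ⊢
        exact this)
      have := (mem_invSet_or ((c.embedding b).lt_iff_lt.mpr hk)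
        ((embedding_lt_of_ne c hb _ _).mpr hlt) hd').resolve_left (hnot _ _ _ _)
      rwa [huniq _ _ _ _ h this]
  have hright : ∀ b b' k l l' d, b ≠ b' →
      (c.embedding b k, c.embedding b' l) ∈ invSet (u d) →
      (c.embedding b k, c.embedding b' l') ∈ invSet (u d) := by
    intro b b' k l l' d hb h
    have hlt : b < b' := (embedding_lt_of_ne c hb _ _).mp h.1
    rcases lt_trichotomy l' l with hk | rfl | hk
    · exact (mem_invSet_or ((embedding_lt_of_ne c hb _ _).mpr hlt)
        ((c.embedding b').lt_iff_lt.mpr hk) h).resolve_right (hnot _ _ _ _)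
    · exact h
    · obtain ⟨d', hd'⟩ := (hout (c.embedding b k) (c.embedding b' l')).mp (by
        have := (hout _ _).mpr ⟨d, h⟩
        rw [mem_invSet_inflate_of_ne _ _ hb] at this ⊢
        exact this)
      have := (mem_invSet_or ((embedding_lt_of_ne c hb _ _).mpr hlt)
        ((c.embedding b').lt_iff_lt.mpr hk) hd').resolve_right (hnot _ _ _ _)
      rwa [huniq _ _ _ _ h this]
  refine ⟨a, invSet_injective (Set.ext fun ⟨x, y⟩ => ⟨fun h => (hout x y).mpr ⟨a, h⟩, fun h => ?_⟩)⟩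
  obtain ⟨b, k, rfl⟩ := exists_eq_embedding c x
  obtain ⟨b', k', rfl⟩ := exists_eq_embedding c y
  by_cases hb : b = b'
  · subst hb
    simp [mem_invSet_inflate_same, invSet_one] at h
  · rw [mem_invSet_inflate_of_ne _ _ hb, ← ha, mem_invSet_pattern hg] at h
    exact hleft _ _ _ _ _ _ hb (hright _ _ _ _ _ _ hb h)

theorem isIrreducible_inflate_single {β : ∀ b : Fin c.length, Perm (Fin (c.blocksFun b))}
    (b : Fin c.length) (hb : IsIrreducible (β b)) (hβ : ∀ b', b' ≠ b → β b' = 1) :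
    IsIrreducible (inflate c 1 β) := by
  rw [isIrreducible_iff]
  intro r u hr hu
  obtain ⟨a, ha⟩ := hb.exists_eq hr (hu.pattern (c.embedding b).strictMono fun i j => by
    rw [mem_invSet_inflate_same])
  have hout := (isDecomposition_iff.mp hu).1
  refine ⟨a, invSet_injective (Set.ext fun ⟨x, y⟩ => ⟨fun h => (hout x y).mpr ⟨a, h⟩, fun h => ?_⟩)⟩
  obtain ⟨b', k, rfl⟩ := exists_eq_embedding c x
  obtain ⟨b'', k', rfl⟩ := exists_eq_embedding c y
  by_cases hb' : b' = b''
  · subst hb'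
    rw [mem_invSet_inflate_same] at h
    by_cases hbb : b' = b
    · subst hbb
      rwa [← ha, mem_invSet_pattern (c.embedding _).strictMono] at h
    · simp [hβ b' hbb, invSet_one] at h
  · simp [mem_invSet_inflate_of_ne _ _ hb', invSet_one] at h

/-- For `m ≥ 3` the permutation `w₀` splits off a simple transposition. -/
theorem eq_two_of_isIrreducible_w0 {m : ℕ} (hm : 2 ≤ m) (h : IsIrreducible (w0 m)) : m = 2 := by
  by_contra hne
  let i : Fin m := ⟨0, by omega⟩
  let j : Fin m := ⟨1, by omega⟩
  let k : Fin m := ⟨2, by omega⟩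
  have hij : i < j := by simp [i, j]
  have hjk : j < k := by simp [j, k]
  have hki : k ≠ i := (hij.trans hjk).ne'
  let s : Perm (Fin m) := Equiv.swap i j
  have hs : (i, j) ∈ invSet s := by simp [mem_invSet, hij, s]
  have hs' : (j, k) ∉ invSet s := by
    simp [mem_invSet, s, Equiv.swap_apply_of_ne_of_ne hki hjk.ne', (hij.trans hjk).le]
  -- The parts are a transposition and its complement: `s` does not invert `(j, k)` and `w0 m * s`
  -- does not invert `(i, j)`, so neither is `w0`.
  obtain ⟨a, ha⟩ := h.exists_eq (u := ![s, w0 m * s]) (by omega) (by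
    rw [isDecomposition_iff]
    simp only [Fin.exists_fin_two, Fin.forall_fin_two]
    simp only [Matrix.cons_val_zero, Matrix.cons_val_one, mem_invSet_w0, mem_invSet_w0_mul]
    refine ⟨fun x y => ⟨fun h => ?_, ?_⟩, fun x y => ?_⟩
    · by_cases h' : (x, y) ∈ invSet s <;> simp [h, h']
    · rintro (h | h)
      exacts [h.1, h.1]
    · by_cases h' : (x, y) ∈ invSet s <;> simp [h'])
  fin_cases a
  · exact hs' (by rw [show s = w0 m from ha, mem_invSet_w0]; exact hjk)
  · have h1 : (i, j) ∈ invSet (w0 m * s) := by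
      rw [show w0 m * s = w0 m from ha, mem_invSet_w0]; exact hij
    exact (mem_invSet_w0_mul.mp h1).2 hs

theorem w0_ne_one {m : ℕ} (hm : 2 ≤ m) : w0 m ≠ 1 := by
  intro h
  have h1 : ((⟨0, by omega⟩, ⟨1, by omega⟩) : Fin m × Fin m) ∈ invSet (w0 m) :=
    mem_invSet_w0.mpr (by simp)
  simp [h, invSet_one] at h1

/-- `IsIrreducible.inflate_cases` leaves each member only its quotient or one pile: a non-trivial `σ
a` kills all `β a b`, while a trivial one leaves exactly one pile, since `w a ≠ 1`. -/
theorem IsRecursiveForm.irreducible_iff {r : ℕ} {hr : 0 < r} {w : Fin r → Perm (Fin n)}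
    (hne : ∀ a, w a ≠ 1)
    {σ : Fin r → Perm (Fin c.length)}
    {β : Fin r → ∀ b : Fin c.length, Perm (Fin (c.blocksFun b))} {q : ℕ}
    (h : IsRecursiveForm hr w c σ β q) :
    (∀ a, IsIrreducible (w a)) ↔ IrreducibilityCriterion hr w c β q := by
  obtain ⟨hw, -, hid, hdec, hindec⟩ := h
  constructor
  · intro hirr
    have hcases := fun a => IsIrreducible.inflate_cases (hw a ▸ hirr a)
    have hone : ∀ a, σ a ≠ 1 → ∀ b, β a b = 1 := fun a ha =>
      (hcases a).resolve_right fun h => ha h.1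
    refine ⟨fun b a => isIrreducible_pile (hw a ▸ hirr a) b, fun a ha => ?_, fun hm => ?_,
      fun hm => ?_⟩
    · have hex : ∃ b, β a b ≠ 1 := by
        by_contra hcon
        push Not at hcon
        refine hne a ?_
        rw [hw a, hid a ha, show β a = fun _ => 1 from funext hcon, inflate_one]
      obtain ⟨b, hb⟩ := hex
      rcases hcases a with h | ⟨-, b', hb'⟩
      · exact absurd (h b) hb
      · have huniq : ∀ y, β a y ≠ 1 → y = b' := fun y hy => by
          by_contra hyb
          exact hy (hb' y hyb)
        exact ⟨b, hb, fun y hy => (huniq y hy).trans (huniq b hb).symm⟩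
    · obtain ⟨h2, hσ, -⟩ := hdec hm
      have hβ := hone _ (by rw [hσ]; exact w0_ne_one h2)
      refine ⟨eq_two_of_isIrreducible_w0 h2 (isIrreducible_quotient (c := c) ?_), hβ⟩
      have := hirr ⟨0, hr⟩
      rwa [hw, hσ, show β ⟨0, hr⟩ = fun _ => 1 from funext hβ] at this
    · obtain ⟨h4, hσ, ⟨h1, hσ1⟩, -⟩ := hindec hm
      have h0 := hone _ (hσ.ne_one (by omega))
      have h1' := hone ⟨1, h1⟩ (by rw [hσ1]; exact hσ.w0_mul.ne_one (by omega))
      exact fun b => ⟨h0 b, h1, h1' b⟩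
  · rintro ⟨hβ, hone, hdec', hindec'⟩ a
    have hlarge : q ≤ a.val + 1 → IsIrreducible (w a) := by
      intro ha
      obtain ⟨b, hb, huniq⟩ := hone a ha
      rw [hw a, hid a ha]
      refine isIrreducible_inflate_single b (hβ b a) fun b' hb' => ?_
      by_contra h
      exact hb' (huniq b' h)
    by_cases hm : IsMinusDecomposable (w ⟨0, hr⟩)
    · obtain ⟨h2, hσ, hq⟩ := hdec hm
      obtain ⟨hl, hb⟩ := hdec' hm
      by_cases ha : a.val = 0
      · obtain rfl : a = ⟨0, hr⟩ := Fin.ext ha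
        rw [hw, hσ, show β ⟨0, hr⟩ = fun _ => 1 from funext hb]
        exact isIrreducible_inflate_one (isIrreducible_w0_two hl)
      · exact hlarge (by omega)
    · obtain ⟨h4, hσ, ⟨h1, hσ1⟩, hq⟩ := hindec hm
      have hb := hindec' hm
      by_cases ha : a.val = 0
      · obtain rfl : a = ⟨0, hr⟩ := Fin.ext ha
        rw [hw, show β ⟨0, hr⟩ = fun _ => 1 from funext fun b => (hb b).1]
        exact isIrreducible_inflate_one (hσ.isIrreducible (by omega))
      by_cases ha1 : a.val = 1
      · obtain rfl : a = ⟨1, h1⟩ := Fin.ext ha1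
        rw [hw, hσ1, show β ⟨1, h1⟩ = fun _ => 1 from funext fun b => (hb b).2.2]
        exact isIrreducible_inflate_one (hσ.w0_mul.isIrreducible (by omega))
      · exact hlarge (by omega)

end Inflation

/-! ### Compositions from convex equivalence relations -/

theorem index_lt_index_iff {n : ℕ} (c : Composition n) (x y : Fin n) :
    c.index x < c.index y ↔ ∃ k ∈ c.boundaries, x.val < k.val ∧ k.val ≤ y.val := by
  have hx := c.lt_sizeUpTo_index_succ x
  have hy := c.sizeUpTo_index_le y
  constructor
  · intro h
    refine ⟨c.boundary (c.index y).castSucc, by simp [Composition.boundaries], ?_, hy⟩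
    exact hx.trans_le (c.monotone_sizeUpTo (Nat.succ_le_of_lt h))
  · rintro ⟨k, hk, h1, h2⟩
    simp only [Composition.boundaries, Finset.mem_map, Finset.mem_univ, true_and] at hk
    obtain ⟨j, rfl⟩ := hk
    have e : ((c.boundary j : Fin (n + 1)) : ℕ) = c.sizeUpTo j := rfl
    simp only [RelEmbedding.coe_toEmbedding, e] at h1 h2
    have h3 : (c.index x : ℕ) < j := by
      by_contra hcon
      have := c.monotone_sizeUpTo (not_lt.mp hcon)
      have := c.sizeUpTo_index_le x
      omega
    have h4 : (j : ℕ) < c.index y + 1 := by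
      by_contra hcon
      have h5 := c.monotone_sizeUpTo (not_lt.mp hcon)
      have h6 := c.lt_sizeUpTo_index_succ y
      simp only [Fin.val_succ] at h6
      omega
    rw [Fin.lt_def]
    omega

/-- Convex classes are intervals, so it suffices to cut between neighbours that are not related. -/
theorem exists_composition {n : ℕ} (R : Fin n → Fin n → Prop) (hR : Equivalence R)
    (hconv : ∀ x y z, x ≤ y → y ≤ z → R x z → R x y) :
    ∃ c : Composition n, ∀ x y, c.index x = c.index y ↔ R x y := by
  classical
  let B : Finset (Fin (n + 1)) := Finset.univ.filter fun k =>
    k.val = 0 ∨ k.val = n ∨ ∃ (h : k.val < n), ¬ R ⟨k.val - 1, by omega⟩ ⟨k.val, h⟩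
  let C : CompositionAsSet n := ⟨B, by simp [B], by simp [B]⟩
  have hB : C.toComposition.boundaries = B := C.toComposition_boundaries
  have key : ∀ x y : Fin n, x ≤ y →
      ((∃ k ∈ C.toComposition.boundaries, x.val < k.val ∧ k.val ≤ y.val) ↔ ¬ R x y) := by
    intro x y hxy
    rw [hB]
    constructor
    · rintro ⟨k, hk, h1, h2⟩ hxy'
      simp only [B, Finset.mem_filter, Finset.mem_univ, true_and] at hk
      rcases hk with hk | hk | ⟨hkn, hk⟩
      · omega
      · omega
      · refine hk (hR.trans (hR.symm (hconv x ⟨k - 1, by omega⟩ y ?_ ?_ hxy'))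
          (hconv x ⟨k, hkn⟩ y ?_ ?_ hxy')) <;> simp only [Fin.le_def] <;> omega
    · intro hnR
      by_contra hcon
      push Not at hcon
      have : ∀ j, ∀ hj : j < n, x.val ≤ j → j ≤ y.val → R x ⟨j, hj⟩ := by
        intro j hj hxj
        induction j, hxj using Nat.le_induction with
        | base => exact fun _ => hR.refl x
        | succ j hxj ih =>
          intro hjy
          refine hR.trans (ih (by omega) (by omega)) ?_
          by_contra hn
          have := hcon ⟨j + 1, by omega⟩ (by
            simp only [B, Finset.mem_filter, Finset.mem_univ, true_and]
            exact Or.inr (Or.inr ⟨hj, hn⟩)) (by simp only; omega)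
          simp only at this
          omega
      exact hnR (this y y.2 hxy le_rfl)
  have key2 : ∀ x y : Fin n, x ≤ y → (C.toComposition.index x = C.toComposition.index y ↔ R x y) := by
    intro x y hxy
    rw [← not_iff_not, ← key x y hxy, ← index_lt_index_iff]
    have : ¬ C.toComposition.index y < C.toComposition.index x := by
      rw [index_lt_index_iff]
      rintro ⟨k, -, h1, h2⟩
      have : x.val ≤ y.val := hxy
      omega
    exact ⟨fun h => lt_of_le_of_ne (not_lt.mp this) h, ne_of_lt⟩
  refine ⟨C.toComposition, fun x y => ?_⟩
  rcases le_total x y with h | h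
  · exact key2 x y h
  · rw [eq_comm, key2 y x h]
    exact ⟨hR.symm, hR.symm⟩

variable {n : ℕ}

theorem index_monotone (c : Composition n) : Monotone c.index := by
  intro x y hxy
  by_contra h
  obtain ⟨k, -, h1, h2⟩ := (index_lt_index_iff c y x).mp (not_le.mp h)
  have : x.val ≤ y.val := hxy
  omega

/-- The first element of a pile. -/
def pileHead (c : Composition n) (b : Fin c.length) : Fin n :=
  c.embedding b ⟨0, c.one_le_blocksFun b⟩

theorem pileHead_strictMono (c : Composition n) : StrictMono (pileHead c) :=
  fun _ _ h => (embedding_lt_of_ne c h.ne _ _).mpr h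

theorem index_pileHead (c : Composition n) (b : Fin c.length) : c.index (pileHead c b) = b :=
  c.index_embedding _ _

theorem embedding_lt_iff_index {c : Composition n} {x y : Fin n} (h : c.index x ≠ c.index y) :
    x < y ↔ c.index x < c.index y := by
  refine ⟨fun hxy => lt_of_le_of_ne (index_monotone c hxy.le) h, fun hxy => ?_⟩
  by_contra hcon
  exact hxy.not_ge (index_monotone c (not_lt.mp hcon))

/-- A permutation for which all piles of `c` are homogeneous is an inflation along `c`. -/
theorem eq_inflate_pattern {c : Composition n} {w : Perm (Fin n)}
    (H : ∀ x y z, c.index y = c.index z → c.index x ≠ c.index y → (w x < w y ↔ w x < w z)) :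
    w = inflate c (pattern (w ∘ pileHead c)) fun b => pattern (w ∘ c.embedding b) := by
  refine eq_inflate_iff.mpr ⟨fun b k k' => ?_, fun b b' k k' hb => ?_⟩
  · rw [pattern_lt_iff (w.injective.comp (c.embedding b).injective)]
    rfl
  · rw [pattern_lt_iff (w.injective.comp (pileHead_strictMono c).injective), Function.comp_apply,
      Function.comp_apply, H _ _ (pileHead c b') (by simp [index_pileHead]) (by simpa)]
    have h1 := H (pileHead c b') (c.embedding b k) (pileHead c b) (by simp [index_pileHead])
      (by simp [index_pileHead, Ne.symm hb])
    have n1 : w (pileHead c b') ≠ w (c.embedding b k) := fun h => hb (by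
      have := congrArg c.index (w.injective h)
      simpa [index_pileHead] using this.symm)
    have n2 : w (pileHead c b') ≠ w (pileHead c b) := fun h => hb (by
      have := congrArg c.index (w.injective h)
      simpa [index_pileHead] using this.symm)
    rw [← not_iff_not, not_lt, not_lt, le_iff_lt_or_eq, le_iff_lt_or_eq, h1]
    simp [n1, n2]

theorem IsDecomposition.comp_perm {r : ℕ} {S : Set (Fin n × Fin n)} {u : Fin r → Perm (Fin n)}
    (hu : IsDecomposition S u) (e : Perm (Fin r)) : IsDecomposition S (u ∘ e) := by
  rw [isDecomposition_iff] at *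
  refine ⟨fun x y => (hu.1 x y).trans ⟨?_, ?_⟩, fun x y a a' h h' => e.injective (hu.2 x y _ _ h h')⟩
  · rintro ⟨a, ha⟩
    exact ⟨e.symm a, by simpa using ha⟩
  · rintro ⟨a, ha⟩
    exact ⟨e a, ha⟩

/-! ### The minus-decomposable case -/

/-- The first member already inverts every pair across its two piles, so all others preserve the
order across them and have identity quotient. -/
theorem exists_isRecursiveForm_of_minusDecomposable {r : ℕ} (hr : 0 < r)
    {w : Fin r → Perm (Fin n)} (hw : IsDecomposition (posRoots n) w)
    (h : IsMinusDecomposable (w ⟨0, hr⟩)) :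
    ∃ (c : Composition n) (σ : Fin r → Perm (Fin c.length))
      (β : Fin r → ∀ b : Fin c.length, Perm (Fin (c.blocksFun b))) (q : ℕ),
      IsRecursiveForm hr w c σ β q := by
  obtain ⟨c, β₀, hc, h0⟩ := id h
  have huniq := (isDecomposition_iff.mp hw).2
  have hcross : ∀ x y, c.index x ≠ c.index y → x < y → (x, y) ∈ invSet (w ⟨0, hr⟩) := by
    intro x y hne hxy
    obtain ⟨b, k, rfl⟩ := exists_eq_embedding c x
    obtain ⟨b', k', rfl⟩ := exists_eq_embedding c y
    simp only [Composition.index_embedding] at hne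
    rw [h0, mem_invSet_inflate_of_ne _ _ hne, mem_invSet_w0]
    exact (embedding_lt_of_ne c hne _ _).mp hxy
  have hlt0 : ∀ x y, c.index x ≠ c.index y → (w ⟨0, hr⟩ x < w ⟨0, hr⟩ y ↔ y < x) := by
    intro x y hne
    rcases lt_trichotomy x y with hxy | rfl | hxy
    · simp [(hcross x y hne hxy).2.not_gt, hxy.not_gt]
    · exact absurd rfl hne
    · simp [(hcross y x hne.symm hxy).2, hxy]
  have hlt : ∀ a, a ≠ ⟨0, hr⟩ → ∀ x y, c.index x ≠ c.index y → (w a x < w a y ↔ x < y) := by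
    intro a ha x y hne
    have key : ∀ x y, c.index x ≠ c.index y → x < y → w a x < w a y := by
      intro x y hne hxy
      by_contra hcon
      have hne' : w a y ≠ w a x := fun h => hxy.ne ((w a).injective h).symm
      exact ha (huniq x y _ _ ⟨hxy, lt_of_le_of_ne (not_lt.mp hcon) hne'⟩ (hcross x y hne hxy))
    rcases lt_trichotomy x y with hxy | rfl | hxy
    · simp [key x y hne hxy, hxy]
    · exact absurd rfl hne
    · simp [(key y x hne.symm hxy).not_gt, hxy.not_gt]
  have hind : ∀ x y z, c.index y = c.index z → c.index x ≠ c.index y → (x < y ↔ x < z) := by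
    intro x y z h1 h2
    have h3 : c.index x ≠ c.index z := h1 ▸ h2
    rw [embedding_lt_iff_index h2, embedding_lt_iff_index h3, h1]
  have H : ∀ a x y z, c.index y = c.index z → c.index x ≠ c.index y →
      (w a x < w a y ↔ w a x < w a z) := by
    intro a x y z h1 h2
    by_cases ha : a = ⟨0, hr⟩
    · subst ha
      have h3 : c.index x ≠ c.index z := h1 ▸ h2
      rw [hlt0 _ _ h2, hlt0 _ _ h3, embedding_lt_iff_index h2.symm,
        embedding_lt_iff_index h3.symm, h1]
    · rw [hlt a ha _ _ h2, hlt a ha _ _ (h1 ▸ h2), hind x y z h1 h2]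
  refine ⟨c, fun a => pattern (w a ∘ pileHead c), fun a b => pattern (w a ∘ c.embedding b), 2,
    fun a => eq_inflate_pattern (H a), fun b => hw.pattern (c.embedding b).strictMono fun i j => ?_,
    fun a ha => ?_, fun _ => ⟨hc.ge, ?_, rfl⟩, fun hn => absurd h hn⟩
  · simp [mem_posRoots]
  · have ha0 : a ≠ ⟨0, hr⟩ := fun h => by simp [h] at ha
    refine perm_eq_of_lt_iff fun b b' => ?_
    rw [pattern_lt_iff ((w a).injective.comp (pileHead_strictMono c).injective)]
    by_cases hb : b = b'
    · simp [hb]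
    · rw [Function.comp_apply, Function.comp_apply, hlt a ha0 _ _ (by simpa [index_pileHead]),
        (pileHead_strictMono c).lt_iff_lt]
      rfl
  · exact (inflate_injective ((eq_inflate_pattern (H _)).symm.trans h0)).1

theorem isMinusDecomposable_of_cut {w : Perm (Fin n)} {k : Fin n} (hk : 0 < k.val)
    (h : ∀ i j, i < k → k ≤ j → (i, j) ∈ invSet w) : IsMinusDecomposable w := by
  obtain ⟨c, hc⟩ := exists_composition (n := n) (fun x y => x < k ↔ y < k)
    ⟨fun _ => Iff.rfl, Iff.symm, Iff.trans⟩ (fun x y z hxy hyz hxz =>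
      ⟨fun hx => hyz.trans_lt (hxz.mp hx), fun hy => hxy.trans_lt hy⟩)
  let z : Fin n := ⟨0, by omega⟩
  have hz : z < k := hk
  have hne : c.index z ≠ c.index k := by
    rw [Ne, hc]
    simp [hz]
  have hcross : ∀ x y, c.index x ≠ c.index y → x < y → (x, y) ∈ invSet w := by
    intro x y hne hxy
    rw [Ne, hc] at hne
    by_cases hx : x < k
    · exact h x y hx (not_lt.mp fun hy => hne (by simp [hx, hy]))
    · exact absurd ⟨fun h => absurd h hx, fun hy => hxy.trans hy⟩ hne
  refine ⟨c, fun b => pattern (w ∘ c.embedding b), ?_, eq_inflate_iff.mpr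
    ⟨fun b l l' => ?_, fun b b' l l' hb => ?_⟩⟩
  · have huniv : (Finset.univ : Finset (Fin c.length)) = {c.index z, c.index k} := by
      ext b
      simp only [Finset.mem_univ, Finset.mem_insert, Finset.mem_singleton, true_iff]
      rw [← index_pileHead c b, hc, hc]
      by_cases hb : pileHead c b < k <;> simp [hb, hz]
    have := congrArg Finset.card huniv
    rwa [Finset.card_pair hne, Finset.card_univ, Fintype.card_fin] at this
  · rw [pattern_lt_iff (w.injective.comp (c.embedding b).injective)]
    rfl
  · rw [w0_lt_iff]
    rcases lt_or_gt_of_ne hb with hlt | hlt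
    · have := hcross (c.embedding b l) (c.embedding b' l') (by simpa)
        ((embedding_lt_of_ne c hb _ _).mpr hlt)
      simp [this.2.not_gt, hlt.not_gt]
    · have := hcross (c.embedding b' l') (c.embedding b l) (by simpa using Ne.symm hb)
        ((embedding_lt_of_ne c (Ne.symm hb) _ _).mpr hlt)
      simp [this.2, hlt]

/-! ### The minus-indecomposable case -/

theorem IsBlock.mem_invSet_left {σ : Perm (Fin n)} {s : Finset (Fin n)} (hs : IsBlock σ s)
    {x y z : Fin n} (hx : x ∉ s) (hy : y ∈ s) (hz : z ∈ s) (h : (x, y) ∈ invSet σ) :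
    (x, z) ∈ invSet σ := by
  refine ⟨?_, (hs.lt_iff hx hy hz).mp h.2⟩
  by_contra hxz
  exact hx (hs.1.out hz hy ⟨not_lt.mp hxz, h.1.le⟩)

theorem IsBlock.mem_invSet_right {σ : Perm (Fin n)} {s : Finset (Fin n)} (hs : IsBlock σ s)
    {x y z : Fin n} (hx : x ∉ s) (hy : y ∈ s) (hz : z ∈ s) (h : (y, x) ∈ invSet σ) :
    (z, x) ∈ invSet σ := by
  refine ⟨?_, ((isBlock_iff.mp hs).2 x y z hx hy hz).mp h.2⟩
  by_contra hxz
  exact hx (hs.1.out hy hz ⟨h.1.le, not_lt.mp hxz⟩)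

/-- The common element `y` is a reference point: an outside element compares with each member of
either block as it does with `y`. -/
theorem IsBlock.union {σ : Perm (Fin n)} {s t : Finset (Fin n)} (hs : IsBlock σ s)
    (ht : IsBlock σ t) {y : Fin n} (hys : y ∈ s) (hyt : y ∈ t) : IsBlock σ (s ∪ t) := by
  have key : ∀ x z, x ∉ s ∪ t → z ∈ s ∪ t → (σ x < σ z ↔ σ x < σ y) := by
    intro x z hx hz
    rw [Finset.mem_union, not_or] at hx
    rcases Finset.mem_union.mp hz with hz | hz
    · exact (isBlock_iff.mp hs).2 x z y hx.1 hz hys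
    · exact (isBlock_iff.mp ht).2 x z y hx.2 hz hyt
  refine isBlock_iff.mpr ⟨?_, fun x z z' hx hz hz' => (key x z hx hz).trans (key x z' hx hz').symm⟩
  have hle : ∀ p q x, p ∈ s ∪ t → q ∈ s ∪ t → p ≤ x → x ≤ q → x ∈ s ∪ t := by
    intro p q x hp hq hpx hxq
    rcases le_total x y with hxy | hxy
    · rcases Finset.mem_union.mp hp with hp | hp
      · exact Finset.mem_union_left _ (hs.1.out hp hys ⟨hpx, hxy⟩)
      · exact Finset.mem_union_right _ (ht.1.out hp hyt ⟨hpx, hxy⟩)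
    · rcases Finset.mem_union.mp hq with hq | hq
      · exact Finset.mem_union_left _ (hs.1.out hys hq ⟨hxy, hxq⟩)
      · exact Finset.mem_union_right _ (ht.1.out hyt hq ⟨hxy, hxq⟩)
  exact ⟨fun p hp q hq x hx => hle p q x hp hq hx.1 hx.2⟩

/-- The first position lies only in `s`, the last only in `t`. The member inverting this pair
inverts every pair from the complement of `t` to `t`, by moving first inside `s` and then inside
`t`; the cut is at the minimum of `t`. -/
theorem exists_isMinusDecomposable_of_cover {r : ℕ} {w : Fin r → Perm (Fin n)}
    (hw : IsDecomposition (posRoots n) w) (hn : 2 ≤ n) {s t : Finset (Fin n)}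
    (hs : ∀ a, IsBlock (w a) s) (ht : ∀ a, IsBlock (w a) t) (hst : s ∪ t = Finset.univ)
    (hs1 : s ≠ Finset.univ) (ht1 : t ≠ Finset.univ) (h0 : (⟨0, by omega⟩ : Fin n) ∈ s) :
    ∃ a, IsMinusDecomposable (w a) := by
  have hcov : ∀ x, x ∉ t → x ∈ s := fun x hx =>
    (Finset.mem_union.mp (hst ▸ Finset.mem_univ x)).resolve_right hx
  let z : Fin n := ⟨0, by omega⟩
  let l : Fin n := ⟨n - 1, by omega⟩
  have hzl : z < l := by
    rw [Fin.lt_def]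
    simp only [z, l]
    omega
  obtain ⟨a, ha⟩ := ((isDecomposition_iff.mp hw).1 z l).mp hzl
  have hz : ∀ x, z ≤ x := fun x => Nat.zero_le _
  have hl : ∀ x, x ≤ l := fun x => Nat.le_pred_of_lt x.2
  have hls : l ∉ s := fun h => hs1 (Finset.eq_univ_of_forall fun x =>
    (hs a).1.out h0 h ⟨hz x, hl x⟩)
  have hlt : l ∈ t := by
    by_contra h
    exact hls (hcov l h)
  have hzt : z ∉ t := fun h => ht1 (Finset.eq_univ_of_forall fun x =>
    (ht a).1.out h hlt ⟨hz x, hl x⟩)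
  have htne : t.Nonempty := ⟨l, hlt⟩
  refine ⟨a, isMinusDecomposable_of_cut (k := t.min' htne) ?_ fun i j hi hj => ?_⟩
  · refine Nat.pos_of_ne_zero fun h => hzt ?_
    rw [show z = t.min' htne from Fin.ext h.symm]
    exact t.min'_mem htne
  · have hit : i ∉ t := fun h => (t.min'_le i h).not_gt hi
    have hjt : j ∈ t := (ht a).1.out (t.min'_mem htne) hlt ⟨hj, hl j⟩
    exact (ht a).mem_invSet_left hit hlt hjt ((hs a).mem_invSet_right hls h0 (hcov i hit) ha)

/-- A decomposition without minus-decomposable members has a prime quotient. -/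
theorem exists_prime_quotient {r : ℕ} {w : Fin r → Perm (Fin n)}
    (hw : IsDecomposition (posRoots n) w) (hn : 2 ≤ n)
    (hind : ∀ a, ¬ IsMinusDecomposable (w a)) :
    ∃ c : Composition n, 2 ≤ c.length ∧
      (∀ a, w a = inflate c (pattern (w a ∘ pileHead c)) fun b => pattern (w a ∘ c.embedding b)) ∧
      ∀ s : Finset (Fin c.length), (∀ a, IsBlock (pattern (w a ∘ pileHead c)) s) →
        ¬ (1 < s.card ∧ s.card < c.length) := by
  let R : Fin n → Fin n → Prop := fun x y =>
    x = y ∨ ∃ s : Finset (Fin n), (∀ a, IsBlock (w a) s) ∧ s ≠ Finset.univ ∧ x ∈ s ∧ y ∈ s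
  let z : Fin n := ⟨0, by omega⟩
  let l : Fin n := ⟨n - 1, by omega⟩
  have hzl : z ≠ l := by
    simp only [z, l, Ne, Fin.mk.injEq]
    omega
  obtain ⟨a₀, -⟩ := ((isDecomposition_iff.mp hw).1 z l).mp
    (lt_of_le_of_ne (show z ≤ l from Nat.zero_le _) hzl)
  have hR : Equivalence R := by
    refine ⟨fun x => Or.inl rfl, ?_, ?_⟩
    · rintro x y (h | ⟨s, hs, hs1, hx, hy⟩)
      exacts [Or.inl h.symm, Or.inr ⟨s, hs, hs1, hy, hx⟩]
    · rintro x y u (rfl | ⟨s, hs, hs1, hx, hy⟩)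
      · exact id
      rintro (rfl | ⟨t, ht, ht1, hy', hu⟩)
      · exact Or.inr ⟨s, hs, hs1, hx, hy⟩
      refine Or.inr ⟨s ∪ t, fun a => (hs a).union (ht a) hy hy', fun hst => ?_,
        Finset.mem_union_left _ hx, Finset.mem_union_right _ hu⟩
      have h0 : z ∈ s ∪ t := hst ▸ Finset.mem_univ z
      rcases Finset.mem_union.mp h0 with h0 | h0
      · obtain ⟨a, ha⟩ := exists_isMinusDecomposable_of_cover hw hn hs ht hst hs1 ht1 h0
        exact hind a ha
      · obtain ⟨a, ha⟩ := exists_isMinusDecomposable_of_cover hw hn ht hs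
          ((Finset.union_comm _ _).trans hst) ht1 hs1 h0
        exact hind a ha
  obtain ⟨c, hc⟩ := exists_composition R hR (by
    rintro x y u hxy hyu (rfl | ⟨s, hs, hs1, hx, hu⟩)
    · exact Or.inl (le_antisymm hxy hyu)
    · exact Or.inr ⟨s, hs, hs1, hx, (hs a₀).1.out hx hu ⟨hxy, hyu⟩⟩)
  have H : ∀ a x y u, c.index y = c.index u → c.index x ≠ c.index y →
      (w a x < w a y ↔ w a x < w a u) := by
    intro a x y u h1 h2
    rw [hc] at h1
    rw [Ne, hc] at h2
    rcases h1 with rfl | ⟨s, hs, hs1, hy, hu⟩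
    · rfl
    · exact (isBlock_iff.mp (hs a)).2 x y u (fun hx => h2 (Or.inr ⟨s, hs, hs1, hx, hy⟩)) hy hu
  have hinf := fun a => eq_inflate_pattern (H a)
  refine ⟨c, ?_, hinf, fun s hs hcard => ?_⟩
  · by_contra hlen
    have : c.index z = c.index l := Fin.ext (by omega)
    rcases (hc _ _).mp this with h | ⟨s, hs, hs1, hz, hl⟩
    · exact hzl h
    · exact hs1 (Finset.eq_univ_of_forall fun x => (hs a₀).1.out hz hl
        ⟨Nat.zero_le _, Nat.le_pred_of_lt x.2⟩)
  -- A non-trivial common block of the quotient pulls back to a proper common block meeting two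
  -- piles, which would then be the same class.
  · obtain ⟨b, hb, b', hb', hne⟩ := Finset.one_lt_card.mp hcard.1
    have hsne : ∃ d, d ∉ s := by
      by_contra h
      push Not at h
      rw [Finset.eq_univ_of_forall h, Finset.card_univ, Fintype.card_fin] at hcard
      exact hcard.2.false
    obtain ⟨d, hd⟩ := hsne
    have hmem : ∀ x, x ∈ Finset.univ.filter (fun x => c.index x ∈ s) ↔ c.index x ∈ s := by simp
    refine hne ?_
    rw [← index_pileHead c b, ← index_pileHead c b', hc]
    refine Or.inr ⟨Finset.univ.filter fun x => c.index x ∈ s, fun a => isBlock_iff.mpr ⟨?_, ?_⟩,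
      fun h => ?_, ?_, ?_⟩
    · refine ⟨fun x hx y hy u hu => ?_⟩
      rw [Finset.mem_coe, hmem] at *
      exact (hs a).1.out hx hy ⟨index_monotone c hu.1, index_monotone c hu.2⟩
    · intro x y u hx hy hu
      rw [hmem] at hx hy hu
      rw [hinf a]
      obtain ⟨i, k, rfl⟩ := exists_eq_embedding c x
      obtain ⟨j, k', rfl⟩ := exists_eq_embedding c y
      obtain ⟨j', k'', rfl⟩ := exists_eq_embedding c u
      rw [Composition.index_embedding] at hx hy hu
      have hij : i ≠ j := fun h => hx (h ▸ hy)
      have hij' : i ≠ j' := fun h => hx (h ▸ hu)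
      rw [inflate_lt_of_ne _ _ hij, inflate_lt_of_ne _ _ hij']
      exact (isBlock_iff.mp (hs a)).2 i j j' hx hy hu
    · have := (hmem (pileHead c d)).mp (by rw [h]; exact Finset.mem_univ _)
      rw [index_pileHead] at this
      exact hd this
    · rw [hmem, index_pileHead]
      exact hb
    · rw [hmem, index_pileHead]
      exact hb'

/-! ### Existence of the recursive form -/

theorem exists_perm_zero_one {r : ℕ} {a b : Fin r} (hab : a ≠ b) (hr : 0 < r) (h1 : 1 < r) :
    ∃ e : Perm (Fin r), e ⟨0, hr⟩ = a ∧ e ⟨1, h1⟩ = b := by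
  have h01 : (⟨0, hr⟩ : Fin r) ≠ ⟨1, h1⟩ := by simp
  refine ⟨swap ⟨0, hr⟩ a * swap ⟨1, h1⟩ (swap ⟨0, hr⟩ a b), ?_, by simp⟩
  rw [Perm.mul_apply, swap_apply_of_ne_of_ne h01, swap_apply_left]
  intro h
  have := congrArg (swap (⟨0, hr⟩ : Fin r) a) h
  simp at this
  exact hab this

theorem exists_isRecursiveForm {r : ℕ} (hr : 0 < r) {w : Fin r → Perm (Fin n)}
    (hw : IsDecomposition (posRoots n) w) (hn : 2 ≤ n) :
    ∃ (e : Perm (Fin r)) (c : Composition n) (σ : Fin r → Perm (Fin c.length))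
      (β : Fin r → ∀ b : Fin c.length, Perm (Fin (c.blocksFun b))) (q : ℕ),
      IsRecursiveForm hr (w ∘ e) c σ β q := by
  by_cases hdec : ∃ a, IsMinusDecomposable (w a)
  · obtain ⟨a, ha⟩ := hdec
    exact ⟨swap ⟨0, hr⟩ a, exists_isRecursiveForm_of_minusDecomposable hr (hw.comp_perm _)
      (by simpa using ha)⟩
  push Not at hdec
  obtain ⟨c, hc2, hinf, hprime⟩ := exists_prime_quotient hw hn hdec
  have hτ : IsDecomposition (posRoots c.length) fun a => pattern (w a ∘ pileHead c) :=
    hw.pattern (pileHead_strictMono c) fun i j => (pileHead_strictMono c).lt_iff_lt.symm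
  have hβ : ∀ b, IsDecomposition (posRoots (c.blocksFun b)) fun a => pattern (w a ∘ c.embedding b) :=
    fun b => hw.pattern (c.embedding b).strictMono fun i j =>
      (c.embedding b).strictMono.lt_iff_lt.symm
  set τ := fun a => pattern (w a ∘ pileHead c)
  have hinf' : ∀ a, w a = inflate c (τ a) fun b => pattern (w a ∘ c.embedding b) := hinf
  have hex := (isDecomposition_iff.mp hτ).1
  have huniq := (isDecomposition_iff.mp hτ).2
  -- With two piles, quotient `w0` is exactly minus-decomposability, which is excluded here.
  have hnw0 : ∀ a, τ a = w0 c.length → c.length ≠ 2 := fun a h hc =>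
    hdec a ⟨c, _, hc, h ▸ hinf' a⟩
  obtain ⟨a, ha⟩ := (hex ⟨0, by omega⟩ ⟨1, by omega⟩).mp (show (0 : ℕ) < 1 by omega)
  have ha1 : τ a ≠ 1 := fun h => by simp [h, invSet_one] at ha
  have hall : (∀ a', a' ≠ a → τ a' = 1) → τ a = w0 c.length := by
    intro h
    refine invSet_injective (Set.ext fun ⟨x, y⟩ => ?_)
    rw [mem_invSet_w0]
    refine ⟨fun h => h.1, fun hxy => ?_⟩
    obtain ⟨a', ha'⟩ := (hex x y).mp hxy
    by_cases haa : a' = a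
    · exact haa ▸ ha'
    · simp [h a' haa, invSet_one] at ha'
  have hc3 : 3 ≤ c.length := by
    by_contra hcon
    have hc : c.length = 2 := by omega
    refine hnw0 a (invSet_injective (Set.ext fun ⟨x, y⟩ => ?_)) hc
    rw [mem_invSet_w0]
    refine ⟨fun h => h.1, fun hxy => ?_⟩
    have hxy' : x.val < y.val := hxy
    have hx : x = ⟨0, by omega⟩ := Fin.ext (by simp only; omega)
    have hy : y = ⟨1, by omega⟩ := Fin.ext (by simp only; omega)
    rw [hx, hy]
    exact ha
  have hpair := ordConnected_pair (i := (⟨0, by omega⟩ : Fin c.length)) (j := ⟨1, by omega⟩) rfl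
  -- If `τ a` were the only non-identity quotient it would be `w0`, and the first two positions
  -- would form a common block, non-trivial as there are at least three piles.
  obtain ⟨b, hba, hb1⟩ : ∃ b, b ≠ a ∧ τ b ≠ 1 := by
    by_contra hcon
    push Not at hcon
    have hblock : ∀ a', IsBlock (τ a') {⟨0, by omega⟩, ⟨1, by omega⟩} := by
      intro a'
      by_cases haa : a' = a
      · rw [haa, hall hcon, ← mul_one (w0 c.length)]
        exact (isBlock_one hpair).w0_mul
      · rw [hcon a' haa]
        exact isBlock_one hpair
    have := hprime _ hblock
    rw [Finset.card_pair (by simp)] at this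
    omega
  have hrest : ∀ d, d ≠ a → d ≠ b → τ d = 1 := by
    intro d hda hdb
    by_contra hd
    exact hτ.false_of_three_ne_one hprime hba hdb.symm hda.symm hb1 ha1 hd
  have hτb : τ b = w0 c.length * τ a := by
    refine invSet_injective (Set.ext fun ⟨x, y⟩ => ?_)
    rw [mem_invSet_w0_mul]
    refine ⟨fun h => ⟨h.1, fun h' => hba (huniq x y _ _ h h')⟩, fun ⟨hxy, h⟩ => ?_⟩
    obtain ⟨d, hd⟩ := (hex x y).mp hxy
    by_cases hda : d = a
    · exact absurd (hda ▸ hd) h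
    by_cases hdb : d = b
    · exact hdb ▸ hd
    · have hd' : (x, y) ∈ invSet (τ d) := hd
      simp [hrest d hda hdb, invSet_one] at hd'
  -- Every block of `τ a` is common to all members: `w0` preserves blocks, and every interval is a
  -- block of the identity.
  have hsimple : IsSimple (τ a) := by
    intro s hs
    refine hprime s fun d => ?_
    by_cases hda : d = a
    · exact hda ▸ hs
    by_cases hdb : d = b
    · have : IsBlock (τ d) s := by
        rw [hdb, hτb]
        exact hs.w0_mul
      exact this
    · have : IsBlock (τ d) s := by
        rw [hrest d hda hdb]
        exact isBlock_one hs.1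
      exact this
  have hr1 : 1 < r := by
    by_contra h
    exact hba (Fin.ext (by omega))
  obtain ⟨e, he0, he1⟩ := exists_perm_zero_one hba.symm hr hr1
  refine ⟨e, c, τ ∘ e, fun i b => pattern (w (e i) ∘ c.embedding b), 3, fun i => hinf' (e i),
    fun b => (hβ b).comp_perm e, fun i hi => hrest _ ?_ ?_, fun h => absurd h (hdec _), fun _ =>
    ⟨?_, ?_, ⟨hr1, ?_⟩, rfl⟩⟩
  · rw [← he0, e.injective.ne_iff, Ne, Fin.ext_iff]
    simp only
    omega
  · rw [← he1, e.injective.ne_iff, Ne, Fin.ext_iff]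
    simp only
    omega
  · have : c.length ≠ 3 := fun h => not_isSimple_three h _ hsimple
    omega
  · simpa only [Function.comp_apply, he0] using hsimple
  · simpa only [Function.comp_apply, he0, he1] using hτb

end InvDecomp

theorem theorem1p6 {n r : ℕ} (hr : 0 < r) (w : Fin r → Equiv.Perm (Fin n))
    (hw : InvDecomp.IsDecomposition (InvDecomp.posRoots n) w)
    (hne : ∀ a, (InvDecomp.invSet (w a)).Nonempty) :
    (∃ (e : Equiv.Perm (Fin r)) (c : Composition n) (σ : Fin r → Equiv.Perm (Fin c.length))
        (β : Fin r → ∀ b : Fin c.length, Equiv.Perm (Fin (c.blocksFun b))) (q : ℕ),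
        InvDecomp.IsRecursiveForm hr (w ∘ e) c σ β q) ∧
      (∀ (e : Equiv.Perm (Fin r)) (c : Composition n) (σ : Fin r → Equiv.Perm (Fin c.length))
        (β : Fin r → ∀ b : Fin c.length, Equiv.Perm (Fin (c.blocksFun b))) (q : ℕ),
        InvDecomp.IsRecursiveForm hr (w ∘ e) c σ β q →
          ((∀ a, InvDecomp.IsIrreducible (w a)) ↔
            InvDecomp.IrreducibilityCriterion hr (w ∘ e) c β q)) := by
  constructor
  · obtain ⟨⟨x, y⟩, hxy, -⟩ := hne ⟨0, hr⟩
    have hlt : x.val < y.val := hxy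
    exact InvDecomp.exists_isRecursiveForm hr hw (by omega)
  · intro e c σ β q h
    have hne' : ∀ a, (w ∘ e) a ≠ 1 := fun a h1 =>
      (hne (e a)).ne_empty (InvDecomp.invSet_eq_empty.mpr h1)
    rw [← h.irreducible_iff hne']
    exact e.forall_congr_right.symm
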